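/- Let $g:\mathbb R\to\mathbb R$ be nondecreasing and left-continuous, with Lebesgue--Stieltjes measure $\mu_g$ ($\mu_g([c,d))=g(d)-g(c)$), and $\Delta g(t)=g(t^+)-g(t)$. Let $D_g=\{t:\Delta g(t)>0\}$, let $C_g$ be the open set of points around which $g$ is constant, let $(a_n,b_n)$ be the connected components of $C_g$, and let $N_g^-$ (resp. $N_g^+$) be the set of the finite $a_n$ (resp. $b_n$) that are not in $D_g$. Let $T>0$ with $0\notin D_g\cup N_g^-$ and $T\notin N_g^+\cup D_g\cup C_g$. Put $t^*=b_n$ for $t\in(a_n,b_n)$ and $t^*=t$ for $t\notin C_g$. For $f:[0,T]\to\mathbb C$ the $g$-derivative at $t\in[0,T]$ is, when the limit exists, $f'_g(t)=\lim_{s\to t^{*+}}\frac{f(s)-f(t^*)}{g(s)-g(t^*)}$ if $t\in D_g\cup C_g$, and $f'_g(t)=\lim_{s\to t}\frac{f(s)-f(t)}{g(s)-g(t)}$ otherwise, the latter limit being over $s\in[0,T]$ with $g(s)\ne g(t)$ (thus one-sided at points of $N_g^\pm\cup\{0,T\}$). A function $f$ is $g$-continuous on $[0,T]$ if for all $t\in[0,T]$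 and $\varepsilon>0$ there is $\delta>0$ with $|f(t)-f(s)|<\varepsilon$ whenever $s\in[0,T]$ and $|g(t)-g(s)|<\delta$; $\mathcal{BC}^2_g([0,T];\mathbb C)$ is the set of $f$ such that $f,f'_g,f''_g$ exist on the whole of $[0,T]$ and are bounded and $g$-continuous there. For $\lambda\in\mathbb C$ with $1+\lambda\Delta g\neq0$ on $[0,T]\cap D_g$, the $g$-exponential is $\exp_g(\lambda;t)=\exp\left(\int_{[0,t)}\tilde\lambda\,d\mu_g\right)$, where $\tilde\lambda(s)=\lambda$ for $s\notin D_g$ and $\tilde\lambda(s)=\ln(1+\lambda\Delta g(s))/\Delta g(s)$ for $s\in D_g$ (principal branch). Let $t_1\in[0,T]\cap D_g$ and $w_1,w_2\in\mathbb R\setminus\{0\}$, and let $w_0=w_1$ on $[0,t_1]$ and $w_0=w_2$ on $(t_1,T]$. Let $\lambda_j^1=iw_j$, $\lambda_j^2=-iw_j$ for $j=1,2$ and, for $k=1,2$, \[\alpha_1^k=\frac{\exp_g(\lambda_1^k;t_1)(1+\lambda_1^k\Delta g(t_1))(\lambda_2^2-\lambda_1^k)}{\exp_g(\lambda_2^1;t_1)(1+\lambda_2^1\Delta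 g(t_1))(\lambda_2^2-\lambda_2^1)},\qquad \alpha_2^k=\frac{\exp_g(\lambda_1^k;t_1)(1+\lambda_1^k\Delta g(t_1))(\lambda_1^k-\lambda_2^1)}{\exp_g(\lambda_2^2;t_1)(1+\lambda_2^2\Delta g(t_1))(\lambda_2^2-\lambda_2^1)}.\] Then the maps \[y_k=\exp_g(\lambda_1^k;\cdot)\,\chi_{[0,t_1]}+\left(\alpha_1^k\exp_g(\lambda_2^1;\cdot)+\alpha_2^k\exp_g(\lambda_2^2;\cdot)\right)\chi_{(t_1,T]},\quad k=1,2,\] are two linearly independent (over $\mathbb C$, as functions on $[0,T]$) solutions of $v''_g(t)+w_0(t)^2v(t)=0$, $t\in[0,T]$, where a solution is a $v\in\mathcal{BC}_g^2([0,T];\mathbb C)$ satisfying the equation at every $t\in[0,T]$. Moreover, for all $x_0,v_0\in\mathbb C$, \[v_h=\frac{\lambda_1^2x_0-v_0}{\lambda_1^2-\lambda_1^1}\,y_1+\frac{v_0-\lambda_1^1x_0}{\lambda_1^2-\lambda_1^1}\,y_2\] is the unique solution on $[0,T]$ of this equation with $v(0)=x_0$, $v'_g(0)=v_0$. -/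

import Mathlib

open Set Filter Topology MeasureTheory

noncomputable section

/-- A derivator: a nondecreasing, left-continuous function `g : ℝ → ℝ`. -/
structure Derivator where
  toFun : ℝ → ℝ
  mono' : Monotone toFun
  left_continuous' : ∀ x, ContinuousWithinAt toFun (Iic x) x

namespace Derivator

instance : CoeFun Derivator (fun _ => ℝ → ℝ) := ⟨Derivator.toFun⟩

/-- The Lebesgue–Stieltjes measure `μ_g`, with `μ_g [c, d) = g d - g c` (see `measure_Ico`).
Mathlib's `Monotone.stieltjesFunction` is the right-continuous version of `g`; its Stieltjes measure
only depends on the one-sided limits of `g`. -/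
def measure (g : Derivator) : Measure ℝ := g.mono'.stieltjesFunction.measure

theorem leftLim_stieltjes (g : Derivator) (x : ℝ) :
    Function.leftLim g.mono'.stieltjesFunction x = g x := by
  have hgl : Tendsto g (𝓝[<] x) (𝓝 (g x)) :=
    (g.left_continuous' x).mono_left (nhdsWithin_mono _ Iio_subset_Iic_self)
  have h1 : ∀ y, g y ≤ g.mono'.stieltjesFunction y := fun y => by
    rw [Monotone.stieltjesFunction_eq]
    exact g.mono'.le_rightLim le_rfl
  have h2 : ∀ y < x, g.mono'.stieltjesFunction y ≤ g x := fun y hy => by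
    rw [Monotone.stieltjesFunction_eq]
    exact g.mono'.rightLim_le hy
  have ht : Tendsto g.mono'.stieltjesFunction (𝓝[<] x) (𝓝 (g x)) := by
    refine tendsto_of_tendsto_of_tendsto_of_le_of_le' hgl tendsto_const_nhds
      (Eventually.of_forall h1) ?_
    filter_upwards [self_mem_nhdsWithin] with y hy using h2 y hy
  exact tendsto_nhds_unique (g.mono'.stieltjesFunction.mono.tendsto_leftLim x) ht

theorem measure_Ico (g : Derivator) (c d : ℝ) :
    g.measure (Ico c d) = ENNReal.ofReal (g d - g c) := by
  rw [measure, StieltjesFunction.measure_Ico, leftLim_stieltjes, leftLim_stieltjes]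

/-- The jump `Δg(t) = g(t⁺) - g(t)`. -/
def jump (g : Derivator) (t : ℝ) : ℝ := Function.rightLim g t - g t

/-- `C_g`: the points around which `g` is constant. -/
def C (g : Derivator) : Set ℝ := {t | ∃ ε > 0, ∀ s ∈ Ioo (t - ε) (t + ε), g s = g t}

/-- `D_g`: the jump points of `g`. -/
def D (g : Derivator) : Set ℝ := {t | 0 < g.jump t}

/-- `N_g⁻`: the (finite) left end points of the connected components `(a_n, b_n)` of `C_g`
that are not in `D_g`. -/
def Nminus (g : Derivator) : Set ℝ :=
  {a | ∃ t ∈ g.C, IsGLB (ordConnectedComponent g.C t) a} \ g.D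

/-- `N_g⁺`: the (finite) right end points of the connected components `(a_n, b_n)` of `C_g`
that are not in `D_g`. -/
def Nplus (g : Derivator) : Set ℝ :=
  {b | ∃ t ∈ g.C, IsLUB (ordConnectedComponent g.C t) b} \ g.D

open Classical in
/-- `t* = b_n` if `t` lies in the component `(a_n, b_n)` of `C_g`, and `t* = t` if `t ∉ C_g`. -/
def star (g : Derivator) (t : ℝ) : ℝ :=
  if t ∈ g.C then sSup (ordConnectedComponent g.C t) else t

open Classical in
/-- The limit that is taken in the `g`-derivative at `t ∈ [0, T]` of a function on `[0, T]`:
`s → t*` from the right if `t ∈ D_g ∪ C_g`, and otherwise `s → t` within `[0, T]`, over the points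
where the difference quotient is defined, `g s ≠ g t`. (So the limit is one-sided, from the right
at `N_g⁺ ∪ {0}` and from the left at `N_g⁻ ∪ {T}`.) -/
def derivFilter (g : Derivator) (T t : ℝ) : Filter ℝ :=
  if t ∈ g.D ∪ g.C then 𝓝[Icc 0 T ∩ Ioi (g.star t)] (g.star t)
  else 𝓝[{s | s ∈ Icc 0 T ∧ g s ≠ g t}] t

/-- The difference quotient in the `g`-derivative at `t`. -/
def quotient (g : Derivator) (f : ℝ → ℂ) (t s : ℝ) : ℂ :=
  (f s - f (g.star t)) / ((g s - g (g.star t) : ℝ) : ℂ)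

/-- `f : [0, T] → ℂ` is `g`-differentiable at `t`. (Functions on `[0, T]` are represented by
functions on `ℝ`, of which only the values on `[0, T]` are used.) -/
def DifferentiableAt (g : Derivator) (T : ℝ) (f : ℝ → ℂ) (t : ℝ) : Prop :=
  ∃ L : ℂ, Tendsto (g.quotient f t) (g.derivFilter T t) (𝓝 L)

/-- The `g`-derivative `f'_g`; meaningful at the points where `f` is `g`-differentiable. -/
def deriv (g : Derivator) (T : ℝ) (f : ℝ → ℂ) (t : ℝ) : ℂ :=
  limUnder (g.derivFilter T t) (g.quotient f t)

/-- The iterated `g`-derivative `f_g^{(k)}`. -/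
def iterDeriv (g : Derivator) (T : ℝ) : ℕ → (ℝ → ℂ) → ℝ → ℂ
  | 0, f => f
  | k + 1, f => g.deriv T (g.iterDeriv T k f)

/-- `f ∈ 𝒞_g([0, T]; ℂ)`. -/
def ContinuousOn (g : Derivator) (T : ℝ) (f : ℝ → ℂ) : Prop :=
  ∀ t ∈ Icc 0 T, ∀ ε > 0, ∃ δ > 0, ∀ s ∈ Icc 0 T, |g t - g s| < δ → ‖f t - f s‖ < ε

/-- `f ∈ 𝒞^k_g([0, T]; ℂ)`. -/
def MemC (g : Derivator) (T : ℝ) : ℕ → (ℝ → ℂ) → Prop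
  | 0, f => g.ContinuousOn T f
  | k + 1, f => g.MemC T k f ∧
      (∀ t ∈ Icc 0 T, g.DifferentiableAt T (g.iterDeriv T k f) t) ∧
      g.ContinuousOn T (g.iterDeriv T (k + 1) f)

/-- `f ∈ ℬ𝒞^k_g([0, T]; ℂ)`: `f ∈ 𝒞^k_g` and `f_g^{(n)}` is bounded on `[0, T]` for `n ≤ k`. -/
def MemBC (g : Derivator) (T : ℝ) (k : ℕ) (f : ℝ → ℂ) : Prop :=
  g.MemC T k f ∧ ∀ n ≤ k, ∃ M : ℝ, ∀ t ∈ Icc 0 T, ‖g.iterDeriv T n f t‖ ≤ M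

open Classical in
/-- The integrand `p̃` of the `g`-exponential (`Complex.log` is the principal branch). -/
def expIntegrand (g : Derivator) (p : ℝ → ℂ) (s : ℝ) : ℂ :=
  if s ∈ g.D then Complex.log (1 + p s * g.jump s) / g.jump s else p s

/-- The `g`-exponential `exp_g(p; t) = exp (∫_{[0,t)} p̃ dμ_g)`. -/
def gexp (g : Derivator) (p : ℝ → ℂ) (t : ℝ) : ℂ :=
  Complex.exp (∫ s in Ico 0 t, g.expIntegrand p s ∂g.measure)

end Derivator

/-- The piecewise constant coefficient `w₀ = w₁` on `[0, t₁]`, `w₀ = w₂` on `(t₁, T]`. -/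
def helmholtzCoeff (t₁ w₁ w₂ : ℝ) (t : ℝ) : ℝ := if t ≤ t₁ then w₁ else w₂

/-- `v` is a solution on `[0, T]` of `v''_g + w₀² v = 0`. -/
def IsHelmholtzSolution (g : Derivator) (T t₁ w₁ w₂ : ℝ) (v : ℝ → ℂ) : Prop :=
  g.MemBC T 2 v ∧
    ∀ t ∈ Icc 0 T, g.iterDeriv T 2 v t + (helmholtzCoeff t₁ w₁ w₂ t : ℂ) ^ 2 * v t = 0

/-- `v` is a solution of `v''_g + w₀² v = 0`, `v(0) = x₀`, `v'_g(0) = v₀`. -/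
def IsHelmholtzIVPSolution (g : Derivator) (T t₁ w₁ w₂ : ℝ) (x₀ v₀ : ℂ) (v : ℝ → ℂ) : Prop :=
  IsHelmholtzSolution g T t₁ w₁ w₂ v ∧ v 0 = x₀ ∧ g.deriv T v 0 = v₀

/-- The exponents `λ^1 = i w` (index `0`) and `λ^2 = -i w` (index `1`). -/
def helmholtzExponent (w : ℝ) : Fin 2 → ℂ := ![Complex.I * w, -(Complex.I * w)]

/-- The coefficient `α_1^k`. -/
def helmholtzAlpha₁ (g : Derivator) (t₁ w₁ w₂ : ℝ) (k : Fin 2) : ℂ :=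
  let l := helmholtzExponent w₁
  let m := helmholtzExponent w₂
  (g.gexp (fun _ => l k) t₁ * (1 + l k * g.jump t₁) * (m 1 - l k)) /
    (g.gexp (fun _ => m 0) t₁ * (1 + m 0 * g.jump t₁) * (m 1 - m 0))

/-- The coefficient `α_2^k`. -/
def helmholtzAlpha₂ (g : Derivator) (t₁ w₁ w₂ : ℝ) (k : Fin 2) : ℂ :=
  let l := helmholtzExponent w₁
  let m := helmholtzExponent w₂
  (g.gexp (fun _ => l k) t₁ * (1 + l k * g.jump t₁) * (l k - m 0)) /
    (g.gexp (fun _ => m 1) t₁ * (1 + m 1 * g.jump t₁) * (m 1 - m 0))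

/-- The functions `y_k = exp_g(λ_1^k; ·) χ_{[0,t₁]}
+ (α_1^k exp_g(λ_2^1; ·) + α_2^k exp_g(λ_2^2; ·)) χ_{(t₁,T]}`. -/
def helmholtzY (g : Derivator) (T t₁ w₁ w₂ : ℝ) (k : Fin 2) (t : ℝ) : ℂ :=
  (Icc 0 t₁).indicator (g.gexp fun _ => helmholtzExponent w₁ k) t +
  (Ioc t₁ T).indicator (fun s =>
    helmholtzAlpha₁ g t₁ w₁ w₂ k * g.gexp (fun _ => helmholtzExponent w₂ 0) s +
    helmholtzAlpha₂ g t₁ w₁ w₂ k * g.gexp (fun _ => helmholtzExponent w₂ 1) s) t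

/-- The combination `v_h = (λ_1^2 x₀ - v₀)/(λ_1^2 - λ_1^1) y_1 + (v₀ - λ_1^1 x₀)/(λ_1^2 - λ_1^1) y_2`. -/
def helmholtzVh (g : Derivator) (T t₁ w₁ w₂ : ℝ) (x₀ v₀ : ℂ) (t : ℝ) : ℂ :=
  let l := helmholtzExponent w₁
  (l 1 * x₀ - v₀) / (l 1 - l 0) * helmholtzY g T t₁ w₁ w₂ 0 t +
    (v₀ - l 0 * x₀) / (l 1 - l 0) * helmholtzY g T t₁ w₁ w₂ 1 t

end

/-!
If `f` has `g`-derivative `L` at `t` and `φ` is holomorphic, then `φ ∘ f` has the `g`-derivative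
`dslope φ z (z + L Δg(t*)) * L`, `z = f(t*)`: a divided difference over the jump. For `φ = exp` and
`f` the indefinite integral of `log(1 + λ Δg) / Δg` this is `λ exp(z)`, so that the `g`-exponential
is an eigenfunction of the `g`-derivative.

A jump of `g` at `t₁` separates `[0, t₁]` from `(t₁, T]` in the topology induced by `g`, and two
functions can be glued there if their limits from the right, `f(t₁⁺) = f(t₁) + f'_g(t₁) Δg(t₁)`,
agree; the coefficients `α_j^k` are the solution of these matching conditions for the function and
for its `g`-derivative. Independence is read off the Wronskian at `0`, and uniqueness is a Grönwall
inequality, proved by induction along `[0, T]`: solutions are continuous from the left, and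
from the right they are controlled by their `g`-derivatives.
-/

theorem isLUB_ordConnectedComponent {α : Type*} [LinearOrder α] [DenselyOrdered α] {s : Set α}
    {a b : α} (hab : a < b) (hs : Ico a b ⊆ s) (hb : b ∉ s) :
    IsLUB (ordConnectedComponent s a) b := by
  refine (isLUB_Ico hab).of_subset_of_superset isLUB_Iic (fun x hx => ?_) fun y hy => ?_
  · rw [mem_ordConnectedComponent, uIcc_of_le hx.1]
    exact (Icc_subset_Ico_right hx.2).trans hs
  · by_contra hby
    rw [mem_Iic, not_le] at hby
    exact hb (hy (mem_uIcc_of_le hab.le hby.le))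

theorem isGLB_ordConnectedComponent {α : Type*} [LinearOrder α] [DenselyOrdered α] {s : Set α}
    {a b : α} (hba : b < a) (hs : Ioc b a ⊆ s) (hb : b ∉ s) :
    IsGLB (ordConnectedComponent s a) b := by
  refine (isGLB_Ioc hba).of_subset_of_superset isGLB_Ici (fun x hx => ?_) fun y hy => ?_
  · rw [mem_ordConnectedComponent, uIcc_of_ge hx.2]
    exact (Icc_subset_Ioc_left hx.1).trans hs
  · by_contra hyb
    rw [mem_Ici, not_le] at hyb
    exact hb (hy (mem_uIcc_of_ge hyb.le hba.le))

theorem Icc_induction {α : Type*} [ConditionallyCompleteLinearOrder α] [TopologicalSpace α]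
    [OrderTopology α] {P : α → Prop} {a b : α} (base : P a)
    (left : ∀ t ∈ Ioc a b, (∀ s ∈ Ico a t, P s) → P t)
    (right : ∀ t ∈ Ico a b, P t → ∀ᶠ s in 𝓝[>] t, P s) : ∀ t ∈ Icc a b, P t := by
  by_contra! hfail
  obtain ⟨c, hc⟩ : ∃ c, IsGLB {t | t ∈ Icc a b ∧ ¬P t} c :=
    ⟨_, isGLB_csInf hfail ⟨a, fun t ht => ht.1.1⟩⟩
  obtain ⟨t, ht, hPt⟩ := hfail
  have hac : a ≤ c := hc.2 fun s hs => hs.1.1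
  have hct : c ≤ t := hc.1 ⟨ht, hPt⟩
  have hlt : ∀ s ∈ Ico a c, P s := fun s hs => by
    by_contra hPs
    exact hs.2.not_ge (hc.1 ⟨⟨hs.1, hs.2.le.trans (hct.trans ht.2)⟩, hPs⟩)
  have hPc : P c := by
    rcases hac.eq_or_lt with rfl | hac
    · exact base
    · exact left c ⟨hac, hct.trans ht.2⟩ hlt
  have hct : c < t := hct.lt_of_ne fun e => hPt (e ▸ hPc)
  obtain ⟨d, hd, hcd⟩ := (mem_nhdsGT_iff_exists_Ioo_subset' hct).1
    (right c ⟨hac, hct.trans_le ht.2⟩ hPc)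
  obtain ⟨s, hs, hcs, hsd⟩ := hc.exists_between hd
  have hcs : c < s := hcs.lt_of_ne fun e => hs.2 (e ▸ hPc)
  exact hs.2 (hcd ⟨hcs, hsd⟩)

theorem le_mul_exp_of_eventually_le {g u : ℝ → ℝ} {a b K : ℝ} (hg : Monotone g)
    (hK : 0 ≤ K) (hua : 0 ≤ u a) (hu : ∀ t ∈ Ioc a b, ContinuousWithinAt u (Iio t) t)
    (hright : ∀ t ∈ Ico a b, ∀ η > 0,
      ∀ᶠ s in 𝓝[>] t, u s ≤ u t + (K * u t + η) * (g s - g t)) :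
    ∀ t ∈ Icc a b, u t ≤ u a * Real.exp (K * (g t - g a)) := by
  have barrier : ∀ ε > 0, ∀ t ∈ Icc a b,
      u t ≤ (u a + ε) * Real.exp ((K + ε) * (g t - g a)) := by
    intro ε hε
    have hbpos : ∀ t, 0 < (u a + ε) * Real.exp ((K + ε) * (g t - g a)) := fun t => by positivity
    refine Icc_induction (by simp [hε.le]) (fun t ht hlt => ?_) fun t ht hPt => ?_
    · refine le_of_tendsto (hu t ht) ?_
      filter_upwards [Ico_mem_nhdsLT ht.1] with s hs
      refine (hlt s hs).trans ?_
      have := hg hs.2.le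
      gcongr
    · filter_upwards [hright t ht _ (mul_pos hε (hbpos t)), self_mem_nhdsWithin] with s hs hts
      have hgts : 0 ≤ g s - g t := sub_nonneg.2 (hg (le_of_lt hts))
      set B := (u a + ε) * Real.exp ((K + ε) * (g t - g a)) with hB
      calc u s ≤ u t + (K * u t + ε * B) * (g s - g t) := hs
        _ ≤ B + (K * B + ε * B) * (g s - g t) := by gcongr
        _ = B * ((K + ε) * (g s - g t) + 1) := by ring
        _ ≤ B * Real.exp ((K + ε) * (g s - g t)) := by
          have := (hbpos t).le
          gcongr
          exact Real.add_one_le_exp _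
        _ = (u a + ε) * Real.exp ((K + ε) * (g s - g a)) := by
          rw [hB, mul_assoc, ← Real.exp_add]
          ring_nf
  intro t ht
  have hlim : Tendsto (fun ε => (u a + ε) * Real.exp ((K + ε) * (g t - g a))) (𝓝[>] 0)
      (𝓝 (u a * Real.exp (K * (g t - g a)))) := by
    refine Tendsto.mono_left ?_ nhdsWithin_le_nhds
    exact Continuous.tendsto' (by fun_prop) _ _ (by simp)
  refine ge_of_tendsto hlim ?_
  filter_upwards [self_mem_nhdsWithin] with ε hε using barrier ε hε t ht

theorem tendsto_setIntegral_nhds_zero_of_integrableOn {α ι E : Type*} [MeasurableSpace α]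
    [NormedAddCommGroup E] [NormedSpace ℝ E] {μ : Measure α} {f : α → E} {A : Set α}
    {l : Filter ι} {s : ι → Set α} (hf : IntegrableOn f A μ) (hs : ∀ i, MeasurableSet (s i))
    (hsA : ∀ᶠ i in l, s i ⊆ A) (hμ : Tendsto (fun i => μ (s i)) l (𝓝 0)) :
    Tendsto (fun i => ∫ x in s i, f x ∂μ) l (𝓝 0) := by
  refine (hf.tendsto_setIntegral_nhds_zero (s := s) (tendsto_of_tendsto_of_tendsto_of_le_of_le
    tendsto_const_nhds hμ (fun _ => zero_le) fun i => Measure.restrict_apply_le A (s i))).congr' ?_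
  filter_upwards [hsA] with i hi
  rw [Measure.restrict_restrict (hs i), inter_eq_left.2 hi]

namespace Derivator

section Basic

variable (g : Derivator) {s t : ℝ}

theorem mem_C_iff : t ∈ g.C ↔ ∀ᶠ s in 𝓝 t, g s = g t :=
  ((nhds_basis_Ioo_pos t).eventually_iff).symm

theorem isOpen_C : IsOpen g.C := by
  simp only [isOpen_iff_mem_nhds, mem_C_iff]
  intro t ht
  filter_upwards [ht.eventually_nhds] with s hs
  rw [mem_C_iff]
  filter_upwards [hs] with r hr
  rw [hr, hs.self_of_nhds]

theorem mem_C_of_mem_Ioo {a b : ℝ} (h : g b ≤ g a) (ht : t ∈ Ioo a b) : t ∈ g.C := by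
  have hconst : ∀ s ∈ Ioo a b, g s = g a := fun s hs =>
    le_antisymm ((g.mono' hs.2.le).trans h) (g.mono' hs.1.le)
  rw [mem_C_iff]
  filter_upwards [isOpen_Ioo.mem_nhds ht] with s hs
  rw [hconst s hs, hconst t ht]

theorem apply_eq_of_Icc_subset_C {a b : ℝ} (hab : a ≤ b) (h : Icc a b ⊆ g.C) : g b = g a := by
  have hderiv : ∀ x ∈ Icc a b, _root_.HasDerivAt g 0 x := fun x hx =>
    (hasDerivAt_const x (g x)).congr_of_eventuallyEq (g.mem_C_iff.1 (h hx))
  exact constant_of_has_deriv_right_zero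
    (fun x hx => (hderiv x hx).continuousAt.continuousWithinAt)
    (fun x hx => (hderiv x (Ico_subset_Icc_self hx)).hasDerivWithinAt) b (right_mem_Icc.2 hab)

theorem jump_nonneg (t : ℝ) : 0 ≤ g.jump t := sub_nonneg.2 (g.mono'.le_rightLim le_rfl)

theorem jump_eq_zero (ht : t ∉ g.D) : g.jump t = 0 := le_antisymm (not_lt.1 ht) (g.jump_nonneg t)

theorem jump_le (hst : s < t) : g.jump s ≤ g t - g s :=
  sub_le_sub_right (g.mono'.rightLim_le hst) _

theorem apply_lt_of_mem_D (hs : s ∈ g.D) (hst : s < t) : g s < g t :=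
  sub_pos.1 (lt_of_lt_of_le hs (g.jump_le hst))

theorem disjoint_D_C : Disjoint g.D g.C := by
  refine disjoint_left.2 fun t hD hC => ?_
  obtain ⟨u, hu, htu⟩ := (nhdsGT_basis t).eventually_iff.1
    ((g.mem_C_iff.1 hC).filter_mono nhdsWithin_le_nhds)
  obtain ⟨s, hs⟩ := exists_between hu
  exact (g.apply_lt_of_mem_D hD hs.1).ne' (htu hs)

theorem tendsto_left (t : ℝ) : Tendsto g (𝓝[<] t) (𝓝 (g t)) :=
  (g.left_continuous' t).mono Iio_subset_Iic_self

theorem tendsto_sub_right (t : ℝ) : Tendsto (fun s => g s - g t) (𝓝[>] t) (𝓝 (g.jump t)) :=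
  (g.mono'.tendsto_rightLim t).sub_const _

theorem continuousAt (ht : t ∉ g.D) : ContinuousAt g t := by
  refine continuousAt_iff_continuous_left'_right'.2 ⟨g.tendsto_left t, ?_⟩
  simpa [ContinuousWithinAt, g.jump_eq_zero ht] using (g.tendsto_sub_right t).add_const (g t)

theorem countable_D : g.D.Countable := by
  refine g.mono'.countable_not_continuousAt.mono ?_
  intro t ht hcont
  have hzero : Tendsto (fun s => g s - g t) (𝓝[>] t) (𝓝 0) := by
    simpa using (hcont.tendsto.mono_left nhdsWithin_le_nhds).sub_const (g t)
  exact ht.ne (tendsto_nhds_unique hzero (g.tendsto_sub_right t))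

theorem tendsto_jump (t : ℝ) : Tendsto g.jump (𝓝[≠] t) (𝓝 0) := by
  rw [← Iio_union_Ioi, nhdsWithin_union]
  refine Tendsto.sup ?_ ?_
  · have hlim : Tendsto (fun s => g t - g s) (𝓝[<] t) (𝓝 0) := by
      simpa using (g.tendsto_left t).const_sub (g t)
    refine squeeze_zero' (Eventually.of_forall g.jump_nonneg) ?_ hlim
    filter_upwards [self_mem_nhdsWithin] with s hs using g.jump_le hs
  · have hright : Tendsto g.mono'.stieltjesFunction (𝓝[>] t) (𝓝 (Function.rightLim g t)) :=
      (g.mono'.stieltjesFunction.right_continuous t).mono Ioi_subset_Ici_self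
    rw [← sub_self (Function.rightLim g t)]
    refine (hright.sub (g.mono'.tendsto_rightLim t)).congr fun s => ?_
    rw [Monotone.stieltjesFunction_eq, jump]

theorem mem_Nplus (hst : s < t) (h : g t ≤ g s) (hD : t ∉ g.D) (hC : t ∉ g.C) : t ∈ g.Nplus := by
  obtain ⟨m, hm⟩ := exists_between hst
  refine ⟨⟨m, g.mem_C_of_mem_Ioo h hm, isLUB_ordConnectedComponent hm.2 (fun x hx => ?_) hC⟩, hD⟩
  exact g.mem_C_of_mem_Ioo h ⟨hm.1.trans_le hx.1, hx.2⟩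

theorem mem_Nminus (hst : s < t) (h : g t ≤ g s) (hC : s ∉ g.C) : s ∈ g.Nminus := by
  obtain ⟨m, hm⟩ := exists_between hst
  refine ⟨⟨m, g.mem_C_of_mem_Ioo h hm, isGLB_ordConnectedComponent hm.1 (fun x hx => ?_) hC⟩,
    fun hD => (g.apply_lt_of_mem_D hD hst).not_ge h⟩
  exact g.mem_C_of_mem_Ioo h ⟨hx.1, hx.2.trans_lt hm.2⟩

end Basic

section Star

variable {g : Derivator} {r s t : ℝ}

theorem star_of_notMem_C (ht : t ∉ g.C) : g.star t = t := if_neg ht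

theorem isLeast_star (htr : t ≤ r) (hr : r ∉ g.C) : IsLeast (Ici t \ g.C) (g.star t) := by
  by_cases ht : t ∈ g.C
  · obtain ⟨m, hm⟩ : ∃ m, IsLeast (Ici t \ g.C) m :=
      ⟨_, (isClosed_Ici.sdiff g.isOpen_C).isLeast_csInf ⟨r, htr, hr⟩ ⟨t, fun x hx => hx.1⟩⟩
    have htm : t < m := hm.1.1.lt_of_ne fun e => hm.1.2 (e ▸ ht)
    have hlub : IsLUB (ordConnectedComponent g.C t) m :=
      isLUB_ordConnectedComponent htm
        (fun x hx => by_contra fun hxC => hx.2.not_ge (hm.2 ⟨hx.1, hxC⟩)) hm.1.2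
    rwa [star, if_pos ht, hlub.csSup_eq (nonempty_ordConnectedComponent.2 ht)]
  · rw [star_of_notMem_C ht]
    exact ⟨⟨self_mem_Ici, ht⟩, fun x hx => hx.1⟩

theorem star_notMem_C (htr : t ≤ r) (hr : r ∉ g.C) : g.star t ∉ g.C := (isLeast_star htr hr).1.2

theorem le_star (htr : t ≤ r) (hr : r ∉ g.C) : t ≤ g.star t := (isLeast_star htr hr).1.1

theorem star_le (htr : t ≤ r) (hr : r ∉ g.C) : g.star t ≤ r := (isLeast_star htr hr).2 ⟨htr, hr⟩

theorem lt_star (ht : t ∈ g.C) (htr : t ≤ r) (hr : r ∉ g.C) : t < g.star t :=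
  (le_star htr hr).lt_of_ne fun e => star_notMem_C htr hr (e ▸ ht)

theorem apply_star (htr : t ≤ r) (hr : r ∉ g.C) : g (g.star t) = g t := by
  by_cases ht : t ∈ g.C
  · have hconst : ∀ s ∈ Ioo t (g.star t), g s = g t := fun s hs =>
      g.apply_eq_of_Icc_subset_C hs.1.le fun x hx => by_contra fun hxC =>
        (hx.2.trans_lt hs.2).not_ge ((isLeast_star htr hr).2 ⟨hx.1, hxC⟩)
    refine tendsto_nhds_unique (g.tendsto_left _) (tendsto_const_nhds.congr' ?_)
    filter_upwards [Ioo_mem_nhdsLT (lt_star ht htr hr)] with s hs using (hconst s hs).symm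
  · rw [star_of_notMem_C ht]

theorem apply_star_lt (ht : t ∈ g.D ∪ g.C) (htr : t ≤ r) (hr : r ∉ g.C) (hs : g.star t < s) :
    g (g.star t) < g s := by
  by_cases hC : t ∈ g.C
  · by_contra! h
    refine star_notMem_C htr hr (g.mem_C_of_mem_Ioo ?_ ⟨lt_star hC htr hr, hs⟩)
    rwa [← apply_star htr hr]
  · rw [star_of_notMem_C hC] at hs ⊢
    exact g.apply_lt_of_mem_D (ht.resolve_right hC) hs

end Star

section DerivFilter

variable (g : Derivator) {T t : ℝ}

theorem derivFilter_le_nhds (T t : ℝ) : g.derivFilter T t ≤ 𝓝 (g.star t) := by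
  unfold derivFilter
  split_ifs with hDC
  · exact nhdsWithin_le_nhds
  · rw [star_of_notMem_C fun hC => hDC (Or.inr hC)]
    exact nhdsWithin_le_nhds

theorem Icc_mem_derivFilter (T t : ℝ) : Icc 0 T ∈ g.derivFilter T t := by
  unfold derivFilter
  split_ifs
  · exact mem_of_superset self_mem_nhdsWithin inter_subset_left
  · exact mem_of_superset self_mem_nhdsWithin fun s hs => hs.1

theorem derivFilter_le_nhdsGT (ht : g.star t ∈ g.D) : g.derivFilter T t ≤ 𝓝[>] g.star t := by
  unfold derivFilter
  split_ifs with hDC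
  · exact nhdsWithin_mono _ inter_subset_right
  · rw [star_of_notMem_C fun hC => hDC (Or.inr hC)] at ht
    exact absurd (Or.inl ht) hDC

theorem derivFilter_eq_nhdsGT (ht : t ∈ g.D ∪ g.C) (hstar : g.star t ∈ Ico 0 T) :
    g.derivFilter T t = 𝓝[>] g.star t := by
  rw [derivFilter, if_pos ht]
  refine le_antisymm (nhdsWithin_mono _ inter_subset_right) ?_
  rw [← nhdsWithin_Ioc_eq_nhdsGT hstar.2]
  exact nhdsWithin_mono _ fun s hs => ⟨⟨hstar.1.trans hs.1.le, hs.2⟩, hs.1⟩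

theorem nhdsGT_inf_principal_le_derivFilter (ht : t ∈ Ico 0 T) (hC : t ∉ g.C) :
    𝓝[>] t ⊓ 𝓟 {s | g s ≠ g t} ≤ g.derivFilter T t := by
  by_cases hD : t ∈ g.D
  · rw [g.derivFilter_eq_nhdsGT (Or.inl hD) (by rwa [star_of_notMem_C hC]), star_of_notMem_C hC]
    exact inf_le_left
  · rw [derivFilter, if_neg (by simp [hC, hD]), ← nhdsWithin_Ioc_eq_nhdsGT ht.2, nhdsWithin,
      inf_assoc, inf_principal]
    exact nhdsWithin_mono _ fun s hs => ⟨⟨ht.1.trans hs.1.1.le, hs.1.2⟩, hs.2⟩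

theorem tendsto_sub_derivFilter (T t : ℝ) :
    Tendsto (fun s => g s - g (g.star t)) (g.derivFilter T t) (𝓝 (g.jump (g.star t))) := by
  by_cases hD : g.star t ∈ g.D
  · exact (g.tendsto_sub_right _).mono_left (g.derivFilter_le_nhdsGT hD)
  · rw [g.jump_eq_zero hD, ← sub_self (g (g.star t))]
    exact ((g.continuousAt hD).tendsto.mono_left (g.derivFilter_le_nhds T t)).sub_const _

end DerivFilter

/-- The conditions on the end points of `[0, T]` under which `[0, T]` is stable under `t ↦ t*` and
the limit in the `g`-derivative is taken along a proper filter at every point of `[0, T]`. -/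
structure IsAdmissible (g : Derivator) (T : ℝ) : Prop where
  pos : 0 < T
  zero_notMem_Nminus : (0 : ℝ) ∉ g.Nminus
  notMem_Nplus : T ∉ g.Nplus
  notMem_D : T ∉ g.D
  notMem_C : T ∉ g.C

namespace IsAdmissible

variable {g : Derivator} {T : ℝ} (h : g.IsAdmissible T) {s t : ℝ}
include h

theorem star_mem (ht : t ∈ Icc 0 T) : g.star t ∈ Icc 0 T :=
  ⟨ht.1.trans (le_star ht.2 h.notMem_C), star_le ht.2 h.notMem_C⟩

theorem apply_zero_lt (h0 : (0 : ℝ) ∉ g.C) (hs : 0 < s) : g 0 < g s := by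
  by_contra! hle
  exact h.zero_notMem_Nminus (g.mem_Nminus hs hle h0)

theorem apply_lt_apply_right (hs : s < T) : g s < g T := by
  by_contra! hle
  exact h.notMem_Nplus (g.mem_Nplus hs hle h.notMem_D h.notMem_C)

theorem star_lt (ht : t ≤ T) (hDC : t ∈ g.D ∪ g.C) : g.star t < T := by
  refine (star_le ht h.notMem_C).lt_of_ne fun e => ?_
  have htT : t < T := ht.lt_of_ne fun e' => by
    rw [e'] at hDC
    exact hDC.elim h.notMem_D h.notMem_C
  have happly := apply_star ht h.notMem_C
  rw [e] at happly
  exact (h.apply_lt_apply_right htT).ne' happly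

theorem derivFilter_neBot (ht : t ∈ Icc 0 T) : (g.derivFilter T t).NeBot := by
  by_cases hDC : t ∈ g.D ∪ g.C
  · rw [g.derivFilter_eq_nhdsGT hDC ⟨(h.star_mem ht).1, h.star_lt ht.2 hDC⟩]
    infer_instance
  have hC : t ∉ g.C := fun hC => hDC (Or.inr hC)
  rw [derivFilter, if_neg hDC]
  rcases ht.1.eq_or_lt with rfl | h0
  · refine (nhdsGT_neBot_of_exists_gt ⟨T, h.pos⟩).mono ?_
    rw [← nhdsWithin_Ioc_eq_nhdsGT h.pos]
    exact nhdsWithin_mono _ fun s hs => ⟨Ioc_subset_Icc_self hs, (h.apply_zero_lt hC hs.1).ne'⟩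
  rcases ht.2.eq_or_lt with rfl | hT
  · refine (nhdsLT_neBot_of_exists_lt ⟨0, h0⟩).mono ?_
    rw [← nhdsWithin_Ico_eq_nhdsLT h0]
    exact nhdsWithin_mono _ fun s hs => ⟨Ico_subset_Icc_self hs, (h.apply_lt_apply_right hs.2).ne⟩
  · rw [g.mem_C_iff] at hC
    refine neBot_iff.2 fun hbot => hC ?_
    rw [nhdsWithin, inf_principal_eq_bot] at hbot
    filter_upwards [hbot, Ioo_mem_nhds h0 hT] with s hs hsT
    by_contra hne
    exact hs ⟨Ioo_subset_Icc_self hsT, hne⟩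

theorem eventually_apply_ne (ht : t ≤ T) :
    ∀ᶠ s in g.derivFilter T t, g s ≠ g (g.star t) := by
  unfold derivFilter
  split_ifs with hDC
  · filter_upwards [self_mem_nhdsWithin] with s hs using (apply_star_lt hDC ht h.notMem_C hs.2).ne'
  · rw [star_of_notMem_C fun hC => hDC (Or.inr hC)]
    filter_upwards [self_mem_nhdsWithin] with s hs using hs.2

end IsAdmissible

/-- `f` has `g`-derivative `L` at `t`, on `[0, T]`. -/
def HasDerivAt (g : Derivator) (T : ℝ) (f : ℝ → ℂ) (L : ℂ) (t : ℝ) : Prop :=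
  Tendsto (g.quotient f t) (g.derivFilter T t) (𝓝 L)

section HasDerivAt

variable {g : Derivator} {T t : ℝ} {f f' : ℝ → ℂ} {L L' : ℂ}

theorem HasDerivAt.deriv (h : g.IsAdmissible T) (ht : t ∈ Icc 0 T) (hf : g.HasDerivAt T f L t) :
    g.deriv T f t = L :=
  have := h.derivFilter_neBot ht
  hf.limUnder_eq

theorem DifferentiableAt.hasDerivAt (hf : g.DifferentiableAt T f t) :
    g.HasDerivAt T f (g.deriv T f t) t := tendsto_nhds_limUnder hf

theorem HasDerivAt.congr (h : g.IsAdmissible T) (ht : t ∈ Icc 0 T) (hf : g.HasDerivAt T f L t)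
    (hff' : EqOn f f' (Icc 0 T)) : g.HasDerivAt T f' L t := by
  refine Tendsto.congr' ?_ hf
  filter_upwards [g.Icc_mem_derivFilter T t] with s hs
  rw [quotient, quotient, hff' hs, hff' (h.star_mem ht)]

theorem HasDerivAt.add (hf : g.HasDerivAt T f L t) (hf' : g.HasDerivAt T f' L' t) :
    g.HasDerivAt T (f + f') (L + L') t := by
  refine (Tendsto.add hf hf').congr fun s => ?_
  simp only [quotient, Pi.add_apply]
  ring

theorem HasDerivAt.const_smul (c : ℂ) (hf : g.HasDerivAt T f L t) :
    g.HasDerivAt T (c • f) (c • L) t := by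
  refine (Tendsto.const_smul hf c).congr fun s => ?_
  simp only [quotient, Pi.smul_apply, smul_eq_mul]
  ring

theorem HasDerivAt.tendsto (h : g.IsAdmissible T) (ht : t ≤ T) (hf : g.HasDerivAt T f L t) :
    Tendsto f (g.derivFilter T t) (𝓝 (f (g.star t) + L * g.jump (g.star t))) := by
  have hsub := (Complex.continuous_ofReal.tendsto _).comp (g.tendsto_sub_derivFilter T t)
  refine ((Tendsto.mul hf hsub).const_add _).congr' ?_
  filter_upwards [h.eventually_apply_ne ht] with s hs
  have hne : ((g s - g (g.star t) : ℝ) : ℂ) ≠ 0 := Complex.ofReal_ne_zero.2 (sub_ne_zero.2 hs)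
  rw [Function.comp_apply, quotient, div_mul_cancel₀ _ hne, add_sub_cancel]

theorem HasDerivAt.tendsto_nhdsGT (h : g.IsAdmissible T) (ht : t ∈ Icc 0 T ∩ g.D)
    (hf : g.HasDerivAt T f L t) : Tendsto f (𝓝[>] t) (𝓝 (f t + L * g.jump t)) := by
  have hstar : g.star t = t := star_of_notMem_C (g.disjoint_D_C.notMem_of_mem_left ht.2)
  have hlim := hf.tendsto h ht.1.2
  rwa [g.derivFilter_eq_nhdsGT (Or.inl ht.2)
    ⟨(h.star_mem ht.1).1, h.star_lt ht.1.2 (Or.inl ht.2)⟩, hstar] at hlim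

theorem HasDerivAt.comp {φ : ℂ → ℂ} (h : g.IsAdmissible T) (ht : t ≤ T)
    (hφ : _root_.DifferentiableAt ℂ φ (f (g.star t)))
    (hφ' : ContinuousAt φ (f (g.star t) + L * g.jump (g.star t))) (hf : g.HasDerivAt T f L t) :
    g.HasDerivAt T (φ ∘ f)
      (dslope φ (f (g.star t)) (f (g.star t) + L * g.jump (g.star t)) * L) t := by
  have hslope : ContinuousAt (dslope φ (f (g.star t)))
      (f (g.star t) + L * g.jump (g.star t)) := by
    by_cases he : f (g.star t) + L * g.jump (g.star t) = f (g.star t)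
    · rw [he, continuousAt_dslope_same]
      exact hφ
    · exact (continuousAt_dslope_of_ne he).2 hφ'
  refine ((hslope.tendsto.comp (hf.tendsto h ht)).mul hf).congr fun s => ?_
  rw [Function.comp_apply, quotient, quotient, Function.comp_apply, Function.comp_apply,
    ← sub_smul_dslope φ, smul_eq_mul]
  ring

end HasDerivAt

section Continuity

/-- The trace on `[0, T]` of the neighbourhoods of `t` in the topology induced by `g`, which is the
topology in which `g`-continuity on `[0, T]` is continuity. -/
def inducedNhds (g : Derivator) (T t : ℝ) : Filter ℝ := comap g (𝓝 (g t)) ⊓ 𝓟 (Icc 0 T)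

variable {g : Derivator} {T s t : ℝ} {f f' : ℝ → ℂ}

theorem continuousOn_iff_tendsto :
    g.ContinuousOn T f ↔ ∀ t ∈ Icc 0 T, Tendsto f (g.inducedNhds T t) (𝓝 (f t)) := by
  refine forall₂_congr fun t _ => ?_
  rw [inducedNhds, ((Metric.nhds_basis_ball.comap g).inf_principal _).tendsto_iff
    Metric.nhds_basis_ball]
  simp only [Metric.mem_ball', dist_eq_norm, mem_inter_iff, mem_preimage, and_imp]
  refine forall₂_congr fun ε _ => exists_congr fun δ => and_congr_right fun _ => ?_
  exact forall_congr' fun s => forall_comm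

theorem tendsto_inducedNhds (T t : ℝ) : Tendsto g (g.inducedNhds T t) (𝓝 (g t)) :=
  tendsto_comap.mono_left inf_le_left

theorem Icc_mem_inducedNhds (T t : ℝ) : Icc 0 T ∈ g.inducedNhds T t :=
  mem_inf_of_right (mem_principal_self _)

theorem Iic_mem_inducedNhds {t₁ : ℝ} (ht₁ : t₁ ∈ g.D) (ht : t ≤ t₁) :
    Iic t₁ ∈ g.inducedNhds T t := by
  have hlt : g t < g t₁ + g.jump t₁ := (g.mono' ht).trans_lt (lt_add_of_pos_right _ ht₁)
  filter_upwards [(tendsto_inducedNhds T t).eventually_lt_const hlt] with s hs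
  by_contra! hts
  linarith [g.jump_le (not_le.1 hts)]

theorem Ioi_mem_inducedNhds {t₁ : ℝ} (ht₁ : t₁ ∈ g.D) (ht : t₁ < t) :
    Ioi t₁ ∈ g.inducedNhds T t := by
  have hlt := g.apply_lt_of_mem_D ht₁ ht
  filter_upwards [(tendsto_inducedNhds T t).eventually_const_lt hlt] with s hs
  exact g.mono'.reflect_lt hs

theorem nhdsLT_le_inducedNhds (ht : t ∈ Ioc 0 T) : 𝓝[<] t ≤ g.inducedNhds T t := by
  refine le_inf (tendsto_iff_comap.1 (g.tendsto_left t)) ?_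
  rw [le_principal_iff]
  filter_upwards [Ico_mem_nhdsLT ht.1] with s hs using ⟨hs.1, hs.2.le.trans ht.2⟩

theorem ContinuousOn.apply_eq (hf : g.ContinuousOn T f) (hs : s ∈ Icc 0 T) (ht : t ∈ Icc 0 T)
    (hst : g s = g t) : f s = f t := by
  have hle : pure s ≤ g.inducedNhds T t :=
    le_inf (tendsto_iff_comap.1 (hst ▸ tendsto_pure_nhds g s)) (by simpa using hs)
  exact tendsto_nhds_unique (tendsto_pure_nhds f s)
    ((continuousOn_iff_tendsto.1 hf t ht).mono_left hle)

/-- The space of bounded `g`-continuous functions on `[0, T]`. As for `Derivator.ContinuousOn`, its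
elements are functions on `ℝ`, on whose values outside `[0, T]` there is no condition. -/
def BC (g : Derivator) (T : ℝ) : Submodule ℂ (ℝ → ℂ) where
  carrier := {f | g.ContinuousOn T f ∧ ∃ M : ℝ, ∀ t ∈ Icc 0 T, ‖f t‖ ≤ M}
  zero_mem' := ⟨continuousOn_iff_tendsto.2 fun _ _ => tendsto_const_nhds, 0, by simp⟩
  add_mem' := by
    rintro f f' ⟨hf, M, hM⟩ ⟨hf', M', hM'⟩
    rw [continuousOn_iff_tendsto] at hf hf'
    exact ⟨continuousOn_iff_tendsto.2 fun t ht => (hf t ht).add (hf' t ht), M + M',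
      fun t ht => norm_add_le_of_le (hM t ht) (hM' t ht)⟩
  smul_mem' := by
    rintro c f ⟨hf, M, hM⟩
    rw [continuousOn_iff_tendsto] at hf
    refine ⟨continuousOn_iff_tendsto.2 fun t ht => (hf t ht).const_smul c, ‖c‖ * M,
      fun t ht => ?_⟩
    rw [Pi.smul_apply, norm_smul]
    exact mul_le_mul_of_nonneg_left (hM t ht) (norm_nonneg c)

namespace BC

theorem congr (hf : f ∈ g.BC T) (hff' : EqOn f f' (Icc 0 T)) : f' ∈ g.BC T := by
  obtain ⟨hf, M, hM⟩ := hf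
  rw [continuousOn_iff_tendsto] at hf
  refine ⟨continuousOn_iff_tendsto.2 fun t ht => ?_, M, fun t ht => hff' ht ▸ hM t ht⟩
  rw [← hff' ht]
  refine (hf t ht).congr' ?_
  filter_upwards [Icc_mem_inducedNhds T t] with s hs using hff' hs

theorem comp {φ : ℂ → ℂ} (hφ : Continuous φ) (hf : f ∈ g.BC T) : φ ∘ f ∈ g.BC T := by
  obtain ⟨hf, M, hM⟩ := hf
  rw [continuousOn_iff_tendsto] at hf
  obtain ⟨K, hK⟩ := (isCompact_closedBall (0 : ℂ) M).exists_bound_of_continuousOn hφ.continuousOn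
  exact ⟨continuousOn_iff_tendsto.2 fun t ht => (hφ.tendsto _).comp (hf t ht), K,
    fun t ht => hK _ (by simpa using hM t ht)⟩

theorem piecewise {t₁ : ℝ} (ht₁ : t₁ ∈ g.D) (hf : f ∈ g.BC T) (hf' : f' ∈ g.BC T) :
    (Iic t₁).piecewise f f' ∈ g.BC T := by
  obtain ⟨hf, M, hM⟩ := hf
  obtain ⟨hf', M', hM'⟩ := hf'
  rw [continuousOn_iff_tendsto] at hf hf'
  refine ⟨continuousOn_iff_tendsto.2 fun t ht => ?_, max M M', fun t ht => ?_⟩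
  · rcases le_or_gt t t₁ with htt₁ | htt₁
    · rw [piecewise_eq_of_mem (Iic t₁) f f' htt₁]
      refine (hf t ht).congr' ?_
      filter_upwards [Iic_mem_inducedNhds ht₁ htt₁] with s hs
      exact (piecewise_eq_of_mem (Iic t₁) f f' hs).symm
    · rw [piecewise_eq_of_notMem (Iic t₁) f f' (notMem_Iic.2 htt₁)]
      refine (hf' t ht).congr' ?_
      filter_upwards [Ioi_mem_inducedNhds ht₁ htt₁] with s hs
      exact (piecewise_eq_of_notMem (Iic t₁) f f' (notMem_Iic.2 hs)).symm
  · by_cases htt₁ : t ∈ Iic t₁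
    · rw [piecewise_eq_of_mem _ _ _ htt₁]
      exact le_max_of_le_left (hM t ht)
    · rw [piecewise_eq_of_notMem _ _ _ htt₁]
      exact le_max_of_le_right (hM' t ht)

end BC

end Continuity

theorem HasDerivAt.piecewise {g : Derivator} {T t t₁ : ℝ} {f₁ f₂ f₁' f₂' : ℝ → ℂ}
    (h : g.IsAdmissible T) (ht₁ : t₁ ∈ g.D) (ht : t ∈ Icc 0 T)
    (h₁ : g.HasDerivAt T f₁ (f₁' t) t) (h₂ : g.HasDerivAt T f₂ (f₂' t) t)
    (hjump : Tendsto (fun s => f₂ s - f₁ s) (𝓝[>] t₁) (𝓝 0)) :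
    g.HasDerivAt T ((Iic t₁).piecewise f₁ f₂) ((Iic t₁).piecewise f₁' f₂' t) t := by
  have hle : t ≤ g.star t := le_star ht.2 h.notMem_C
  rcases lt_trichotomy (g.star t) t₁ with hu | hu | hu
  · rw [piecewise_eq_of_mem (Iic t₁) f₁' f₂' (hle.trans hu.le)]
    refine Tendsto.congr' ?_ h₁
    filter_upwards [g.derivFilter_le_nhds T t (Iio_mem_nhds hu)] with s hs
    rw [quotient, quotient, piecewise_eq_of_mem _ _ _ (mem_Iic.2 (le_of_lt hs)),
      piecewise_eq_of_mem _ _ _ (mem_Iic.2 hu.le)]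
  · rw [piecewise_eq_of_mem (Iic t₁) f₁' f₂' (hle.trans hu.le), ← add_zero (f₁' t)]
    have hDstar : g.star t ∈ g.D := hu.symm ▸ ht₁
    have hright := g.derivFilter_le_nhdsGT (T := T) hDstar
    have hjump' : Tendsto (fun s => (f₂ s - f₁ s) / ((g s - g (g.star t) : ℝ) : ℂ))
        (g.derivFilter T t) (𝓝 0) := by
      have hne : (g.jump (g.star t) : ℂ) ≠ 0 := Complex.ofReal_ne_zero.2 (ne_of_gt hDstar)
      rw [← hu] at hjump
      rw [← zero_div (g.jump (g.star t) : ℂ)]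
      exact (hjump.mono_left hright).div
        ((Complex.continuous_ofReal.tendsto _).comp (g.tendsto_sub_derivFilter T t)) hne
    refine (Tendsto.add h₁ hjump').congr' ?_
    filter_upwards [hright self_mem_nhdsWithin] with s hs
    rw [hu, mem_Ioi] at hs
    rw [quotient, quotient, piecewise_eq_of_notMem _ _ _ (notMem_Iic.2 hs),
      piecewise_eq_of_mem _ _ _ (mem_Iic.2 hu.le)]
    ring
  · have htt₁ : t₁ < t := by
      by_contra! htt₁
      exact hu.not_ge (star_le htt₁ (g.disjoint_D_C.notMem_of_mem_left ht₁))
    rw [piecewise_eq_of_notMem (Iic t₁) f₁' f₂' (notMem_Iic.2 htt₁)]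
    refine Tendsto.congr' ?_ h₂
    filter_upwards [g.derivFilter_le_nhds T t (Ioi_mem_nhds hu)] with s hs
    rw [quotient, quotient, piecewise_eq_of_notMem _ _ _ (notMem_Iic.2 hs),
      piecewise_eq_of_notMem _ _ _ (notMem_Iic.2 hu)]

section SolutionPair

variable {g : Derivator} {T t t₁ : ℝ} {a a₁ a₂ f f' f₁ f₁' f₂ f₂' : ℝ → ℂ}

theorem HasDerivAt.eventually_norm_le {L : ℂ} {η : ℝ} (ht : t ∈ Ico 0 T)
    (hfc : g.ContinuousOn T f) (hf : g.HasDerivAt T f L t) (hη : 0 < η) :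
    ∀ᶠ s in 𝓝[>] t, ‖f s‖ ≤ ‖f t‖ + (‖L‖ + η) * (g s - g t) := by
  have happly : ∀ s ∈ Ioc t T, g s = g t → ‖f s‖ ≤ ‖f t‖ + (‖L‖ + η) * (g s - g t) := by
    intro s hs hst
    rw [hfc.apply_eq ⟨ht.1.trans hs.1.le, hs.2⟩ (Ico_subset_Icc_self ht) hst, hst, sub_self,
      mul_zero, add_zero]
  by_cases hC : t ∈ g.C
  · filter_upwards [nhdsWithin_le_nhds (g.mem_C_iff.1 hC), Ioc_mem_nhdsGT ht.2] with s hst hs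
    exact happly s hs hst
  have hquot : ∀ᶠ s in g.derivFilter T t, ‖g.quotient f t s‖ < ‖L‖ + η :=
    hf.norm.eventually_lt_const (lt_add_of_pos_right _ hη)
  filter_upwards [eventually_inf_principal.1
    (g.nhdsGT_inf_principal_le_derivFilter ht hC hquot), Ioc_mem_nhdsGT ht.2] with s hs hsT
  by_cases hst : g s = g t
  · exact happly s hsT hst
  have hpos : 0 < g s - g t := sub_pos.2 ((g.mono' hsT.1.le).lt_of_ne' hst)
  have hlt : ‖f s - f t‖ / (g s - g t) < ‖L‖ + η := by
    simpa only [quotient, star_of_notMem_C hC, norm_div, Complex.norm_real, Real.norm_eq_abs,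
      abs_of_pos hpos] using hs hst
  linarith [norm_le_norm_add_norm_sub' (f s) (f t), (div_lt_iff₀ hpos).1 hlt]

/-- `f` is a solution in `ℬ𝒞²_g` of `f''_g = a f` on `[0, T]`, and `f'` is its `g`-derivative; that
is, `(f, f')` solves the first order system equivalent to the equation. -/
structure IsSolutionPair (g : Derivator) (T : ℝ) (a f f' : ℝ → ℂ) : Prop where
  mem_BC : f ∈ g.BC T
  mem_BC' : f' ∈ g.BC T
  hasDerivAt : ∀ t ∈ Icc 0 T, g.HasDerivAt T f (f' t) t
  hasDerivAt' : ∀ t ∈ Icc 0 T, g.HasDerivAt T f' (a t * f t) t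

namespace IsSolutionPair

theorem add (h₁ : g.IsSolutionPair T a f₁ f₁') (h₂ : g.IsSolutionPair T a f₂ f₂') :
    g.IsSolutionPair T a (f₁ + f₂) (f₁' + f₂') where
  mem_BC := add_mem h₁.mem_BC h₂.mem_BC
  mem_BC' := add_mem h₁.mem_BC' h₂.mem_BC'
  hasDerivAt t ht := (h₁.hasDerivAt t ht).add (h₂.hasDerivAt t ht)
  hasDerivAt' t ht := by
    rw [Pi.add_apply, mul_add]
    exact (h₁.hasDerivAt' t ht).add (h₂.hasDerivAt' t ht)

theorem const_smul (c : ℂ) (hf : g.IsSolutionPair T a f f') :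
    g.IsSolutionPair T a (c • f) (c • f') where
  mem_BC := Submodule.smul_mem _ c hf.mem_BC
  mem_BC' := Submodule.smul_mem _ c hf.mem_BC'
  hasDerivAt t ht := (hf.hasDerivAt t ht).const_smul c
  hasDerivAt' t ht := by
    rw [Pi.smul_apply, mul_smul_comm]
    exact (hf.hasDerivAt' t ht).const_smul c

theorem congr (h : g.IsAdmissible T) (h₁ : g.IsSolutionPair T a f₁ f₁')
    (hf : EqOn f₁ f₂ (Icc 0 T)) (hf' : EqOn f₁' f₂' (Icc 0 T)) :
    g.IsSolutionPair T a f₂ f₂' where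
  mem_BC := BC.congr h₁.mem_BC hf
  mem_BC' := BC.congr h₁.mem_BC' hf'
  hasDerivAt t ht := hf' ht ▸ (h₁.hasDerivAt t ht).congr h ht hf
  hasDerivAt' t ht := hf ht ▸ (h₁.hasDerivAt' t ht).congr h ht hf'

/-- The hypotheses say that the values and the `g`-derivatives of the two solutions have the same
limit at `t₁` from the right, `f(t₁⁺) = f(t₁) + f'_g(t₁) Δg(t₁)`. -/
theorem piecewise (h : g.IsAdmissible T) (ht₁ : t₁ ∈ Icc 0 T ∩ g.D)
    (h₁ : g.IsSolutionPair T a₁ f₁ f₁') (h₂ : g.IsSolutionPair T a₂ f₂ f₂')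
    (hf : f₁ t₁ + f₁' t₁ * g.jump t₁ = f₂ t₁ + f₂' t₁ * g.jump t₁)
    (hf' : f₁' t₁ + a₁ t₁ * f₁ t₁ * g.jump t₁ = f₂' t₁ + a₂ t₁ * f₂ t₁ * g.jump t₁) :
    g.IsSolutionPair T ((Iic t₁).piecewise a₁ a₂) ((Iic t₁).piecewise f₁ f₂)
      ((Iic t₁).piecewise f₁' f₂') where
  mem_BC := BC.piecewise ht₁.2 h₁.mem_BC h₂.mem_BC
  mem_BC' := BC.piecewise ht₁.2 h₁.mem_BC' h₂.mem_BC'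
  hasDerivAt t ht := by
    refine (h₁.hasDerivAt t ht).piecewise h ht₁.2 ht (h₂.hasDerivAt t ht) ?_
    have hlim := ((h₂.hasDerivAt t₁ ht₁.1).tendsto_nhdsGT h ht₁).sub
      ((h₁.hasDerivAt t₁ ht₁.1).tendsto_nhdsGT h ht₁)
    rwa [hf, sub_self] at hlim
  hasDerivAt' t ht := by
    rw [← Pi.mul_apply ((Iic t₁).piecewise a₁ a₂), ← piecewise_mul]
    refine HasDerivAt.piecewise h ht₁.2 ht (h₁.hasDerivAt' t ht) (h₂.hasDerivAt' t ht) ?_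
    have hlim := ((h₂.hasDerivAt' t₁ ht₁.1).tendsto_nhdsGT h ht₁).sub
      ((h₁.hasDerivAt' t₁ ht₁.1).tendsto_nhdsGT h ht₁)
    rwa [hf', sub_self] at hlim

theorem eqOn_zero {M : ℝ} (ha : ∀ t ∈ Icc 0 T, ‖a t‖ ≤ M) (hf : g.IsSolutionPair T a f f')
    (h0 : f 0 = 0) (h0' : f' 0 = 0) : EqOn f 0 (Icc 0 T) := by
  have hleft : ∀ t ∈ Ioc 0 T, ContinuousWithinAt (fun s => ‖f s‖ + ‖f' s‖) (Iio t) t := by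
    intro t ht
    have htT := Ioc_subset_Icc_self ht
    exact (((continuousOn_iff_tendsto.1 hf.mem_BC.1 t htT).norm.add
      (continuousOn_iff_tendsto.1 hf.mem_BC'.1 t htT).norm).mono_left (nhdsLT_le_inducedNhds ht))
  have hright : ∀ t ∈ Ico 0 T, ∀ η > 0, ∀ᶠ s in 𝓝[>] t, ‖f s‖ + ‖f' s‖ ≤
      ‖f t‖ + ‖f' t‖ + (max 1 M * (‖f t‖ + ‖f' t‖) + η) * (g s - g t) := by
    intro t ht η hη
    have htT := Ico_subset_Icc_self ht
    have hderiv : ‖f' t‖ ≤ max 1 M * ‖f' t‖ :=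
      le_mul_of_one_le_left (norm_nonneg _) (le_max_left _ _)
    have hderiv' : ‖a t * f t‖ ≤ max 1 M * ‖f t‖ := by
      rw [norm_mul]
      exact mul_le_mul_of_nonneg_right ((ha t htT).trans (le_max_right _ _)) (norm_nonneg _)
    filter_upwards [(hf.hasDerivAt t htT).eventually_norm_le ht hf.mem_BC.1 (half_pos hη),
      (hf.hasDerivAt' t htT).eventually_norm_le ht hf.mem_BC'.1 (half_pos hη),
      self_mem_nhdsWithin] with s hs hs' hts
    have hsum : ‖f' t‖ + η / 2 + (‖a t * f t‖ + η / 2) ≤ max 1 M * (‖f t‖ + ‖f' t‖) + η := by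
      linarith
    have hg : 0 ≤ g s - g t := sub_nonneg.2 (g.mono' (le_of_lt hts))
    linarith [mul_le_mul_of_nonneg_right hsum hg]
  have hzero : ‖f 0‖ + ‖f' 0‖ = 0 := by rw [h0, h0', norm_zero, add_zero]
  intro t ht
  have hle := le_mul_exp_of_eventually_le (u := fun s => ‖f s‖ + ‖f' s‖) g.mono'
    (zero_le_one.trans (le_max_left 1 M)) hzero.ge hleft hright t ht
  simp only [hzero, zero_mul] at hle
  exact norm_le_zero_iff.1 ((le_add_of_nonneg_right (norm_nonneg _)).trans hle)

theorem eqOn {M : ℝ} (ha : ∀ t ∈ Icc 0 T, ‖a t‖ ≤ M) (h₁ : g.IsSolutionPair T a f₁ f₁')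
    (h₂ : g.IsSolutionPair T a f₂ f₂') (h0 : f₁ 0 = f₂ 0) (h0' : f₁' 0 = f₂' 0) :
    EqOn f₁ f₂ (Icc 0 T) := by
  have hzero := (h₁.add (h₂.const_smul (-1))).eqOn_zero ha (by simp [h0]) (by simp [h0'])
  intro t ht
  simpa [← sub_eq_add_neg, sub_eq_zero] using hzero ht

end IsSolutionPair

theorem linearIndependent_of_wronskian_ne_zero (h : g.IsAdmissible T) (ht : t ∈ Icc 0 T)
    {f : Fin 2 → ℝ → ℂ} {L : Fin 2 → ℂ} (hf : ∀ k, g.HasDerivAt T (f k) (L k) t)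
    (hW : f 0 t * L 1 - f 1 t * L 0 ≠ 0) :
    LinearIndependent ℂ fun k => (Icc 0 T).domRestrict (f k) := by
  refine Fintype.linearIndependent_iff.2 fun c hc => ?_
  have hzero : EqOn (c 0 • f 0 + c 1 • f 1) 0 (Icc 0 T) := fun s hs => by
    simpa [Fin.sum_univ_two] using congr_fun hc ⟨s, hs⟩
  have hval : c 0 * f 0 t + c 1 * f 1 t = 0 := hzero ht
  have hderiv : c 0 * L 0 + c 1 * L 1 = 0 := by
    have hsum := (((hf 0).const_smul (c 0)).add ((hf 1).const_smul (c 1))).congr h ht hzero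
    have hconst : g.HasDerivAt T 0 0 t := by simpa only [zero_smul] using (hf 0).const_smul 0
    exact (hsum.deriv h ht).symm.trans (hconst.deriv h ht)
  have h0 : c 0 * (f 0 t * L 1 - f 1 t * L 0) = 0 := by
    linear_combination L 1 * hval - f 1 t * hderiv
  have h1 : c 1 * (f 0 t * L 1 - f 1 t * L 0) = 0 := by
    linear_combination f 0 t * hderiv - L 0 * hval
  exact Fin.forall_fin_two.2
    ⟨(mul_eq_zero.1 h0).resolve_right hW, (mul_eq_zero.1 h1).resolve_right hW⟩

end SolutionPair

section Primitive

instance (g : Derivator) : IsLocallyFiniteMeasure g.measure :=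
  inferInstanceAs (IsLocallyFiniteMeasure g.mono'.stieltjesFunction.measure)

theorem measureReal_Ico (g : Derivator) {s t : ℝ} (hst : s ≤ t) :
    g.measure.real (Ico s t) = g t - g s := by
  rw [measureReal_def, measure_Ico, ENNReal.toReal_ofReal (sub_nonneg.2 (g.mono' hst))]

theorem measureReal_singleton (g : Derivator) (t : ℝ) : g.measure.real {t} = g.jump t := by
  rw [measureReal_def, measure, StieltjesFunction.measure_singleton, leftLim_stieltjes,
    Monotone.stieltjesFunction_eq, ← jump, ENNReal.toReal_ofReal (g.jump_nonneg t)]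

theorem tendsto_measure_Ioo (g : Derivator) (t : ℝ) :
    Tendsto (fun s => g.measure (Ioo t s)) (𝓝[>] t) (𝓝 0) := by
  have hlim : Tendsto (fun s => ENNReal.ofReal (g s - g t - g.jump t)) (𝓝[>] t) (𝓝 0) := by
    simpa using ENNReal.tendsto_ofReal ((g.tendsto_sub_right t).sub_const (g.jump t))
  refine hlim.congr fun s => ?_
  rw [measure, StieltjesFunction.measure_Ioo, leftLim_stieltjes, Monotone.stieltjesFunction_eq,
    jump, sub_sub, add_sub_cancel]

/-- The indefinite integral `t ↦ ∫_{[0,t)} φ dμ_g`, for `t ≥ 0`. -/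
noncomputable def primitive (g : Derivator) (φ : ℝ → ℂ) (t : ℝ) : ℂ :=
  ∫ s in Ico 0 t, φ s ∂g.measure

variable {g : Derivator} {φ : ℝ → ℂ} (hφ : LocallyIntegrable φ g.measure) {s t : ℝ}
include hφ

theorem integrableOn_Ico (s t : ℝ) : IntegrableOn φ (Ico s t) g.measure :=
  (hφ.integrableOn_isCompact isCompact_Icc).mono_set Ico_subset_Icc_self

theorem primitive_sub_primitive (hs : 0 ≤ s) (hst : s ≤ t) :
    g.primitive φ t - g.primitive φ s = ∫ r in Ico s t, φ r ∂g.measure := by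
  rw [sub_eq_iff_eq_add', primitive, primitive, ← Ico_union_Ico_eq_Ico hs hst,
    setIntegral_union ?_ measurableSet_Ico (integrableOn_Ico hφ 0 s) (integrableOn_Ico hφ s t)]
  exact disjoint_left.2 fun r hr hr' => hr.2.not_ge hr'.1

theorem norm_primitive_sub_sub_le {c : ℂ} {K : ℝ} (hs : 0 ≤ s) (ht : 0 ≤ t)
    (hK : ∀ r ∈ uIcc s t, ‖φ r - c‖ ≤ K) :
    ‖g.primitive φ s - g.primitive φ t - c * (g s - g t : ℝ)‖ ≤ K * |g s - g t| := by
  wlog hts : t ≤ s generalizing s t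
  · have hswap : g.primitive φ s - g.primitive φ t - c * (g s - g t : ℝ) =
        -(g.primitive φ t - g.primitive φ s - c * (g t - g s : ℝ)) := by
      push_cast
      ring
    rw [hswap, norm_neg, abs_sub_comm]
    exact this ht hs (by rwa [uIcc_comm]) (le_of_not_ge hts)
  have hconst : ∫ _ in Ico t s, c ∂g.measure = c * (g s - g t : ℝ) := by
    rw [setIntegral_const, g.measureReal_Ico hts, Complex.real_smul, mul_comm]
  have hlt : g.measure (Ico t s) < ⊤ := measure_Ico_lt_top
  rw [primitive_sub_primitive hφ ht hts, ← hconst,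
    ← integral_sub (integrableOn_Ico hφ t s) (integrableOn_const hlt.ne),
    abs_of_nonneg (sub_nonneg.2 (g.mono' hts)), ← g.measureReal_Ico hts]
  refine norm_setIntegral_le_of_norm_le_const hlt fun r hr => hK r ?_
  rw [uIcc_of_ge hts]
  exact Ico_subset_Icc_self hr

theorem norm_primitive_sub_primitive (hs : 0 ≤ s) (ht : 0 ≤ t) :
    ‖g.primitive φ s - g.primitive φ t‖ =
      ‖∫ r in Ico (min s t) (max s t), φ r ∂g.measure‖ := by
  wlog hts : t ≤ s generalizing s t
  · rw [norm_sub_rev, min_comm, max_comm]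
    exact this ht hs (le_of_not_ge hts)
  rw [min_eq_right hts, max_eq_left hts, primitive_sub_primitive hφ ht hts]

theorem primitive_mem_BC (T : ℝ) : g.primitive φ ∈ g.BC T := by
  have hint := integrableOn_Ico hφ 0 T
  refine ⟨continuousOn_iff_tendsto.2 fun t ht => ?_, ∫ r in Ico 0 T, ‖φ r‖ ∂g.measure,
    fun t ht => ?_⟩
  · have hsub : ∀ᶠ s in g.inducedNhds T t, Ico (min s t) (max s t) ⊆ Ico 0 T := by
      filter_upwards [Icc_mem_inducedNhds T t] with s hs
      exact Ico_subset_Ico (le_min hs.1 ht.1) (max_le hs.2 ht.2)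
    have hmeasure : Tendsto (fun s => g.measure (Ico (min s t) (max s t)))
        (g.inducedNhds T t) (𝓝 0) := by
      have hlim := ENNReal.tendsto_ofReal ((tendsto_inducedNhds (g := g) T t).sub_const (g t)).abs
      rw [sub_self, abs_zero, ENNReal.ofReal_zero] at hlim
      refine hlim.congr fun s => ?_
      rw [measure_Ico, g.mono'.map_max, g.mono'.map_min, max_sub_min_eq_abs, abs_sub_comm]
    rw [tendsto_iff_norm_sub_tendsto_zero]
    refine (tendsto_zero_iff_norm_tendsto_zero.1 (tendsto_setIntegral_nhds_zero_of_integrableOn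
      hint (fun _ => measurableSet_Ico) hsub hmeasure)).congr' ?_
    filter_upwards [Icc_mem_inducedNhds T t] with s hs
    exact (norm_primitive_sub_primitive hφ hs.1 ht.1).symm
  · exact (norm_integral_le_integral_norm _).trans (setIntegral_mono_set hint.norm
      (Eventually.of_forall fun _ => norm_nonneg _) (Ico_subset_Ico_right ht.2).eventuallyLE)

theorem tendsto_primitive_sub_right (ht : 0 ≤ t) :
    Tendsto (fun s => g.primitive φ s - g.primitive φ t) (𝓝[>] t) (𝓝 (φ t * g.jump t)) := by
  have hIoo : Tendsto (fun s => ∫ r in Ioo t s, φ r ∂g.measure) (𝓝[>] t) (𝓝 0) := by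
    refine tendsto_setIntegral_nhds_zero_of_integrableOn (integrableOn_Ico hφ t (t + 1))
      (fun _ => measurableSet_Ioo) ?_ (g.tendsto_measure_Ioo t)
    filter_upwards [Ioc_mem_nhdsGT (lt_add_one t)] with s hs
    exact (Ioo_subset_Ioo_right hs.2).trans Ioo_subset_Ico_self
  have hadd := hIoo.const_add (φ t * g.jump t)
  rw [add_zero] at hadd
  refine hadd.congr' ?_
  filter_upwards [self_mem_nhdsWithin] with s hs
  have hint := integrableOn_Ico hφ t s
  rw [primitive_sub_primitive hφ ht (le_of_lt hs), ← Ioo_insert_left hs, ← singleton_union] at *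
  rw [setIntegral_union (by simp) measurableSet_Ioo hint.left_of_union hint.right_of_union,
    integral_singleton, measureReal_singleton, Complex.real_smul, mul_comm]

theorem hasDerivAt_primitive {T : ℝ} (h : g.IsAdmissible T) (ht : t ∈ Icc 0 T)
    (hcont : g.star t ∉ g.D → ContinuousAt φ (g.star t)) :
    g.HasDerivAt T (g.primitive φ) (φ (g.star t)) t := by
  have hstar := h.star_mem ht
  by_cases hD : g.star t ∈ g.D
  · have hne : (g.jump (g.star t) : ℂ) ≠ 0 := Complex.ofReal_ne_zero.2 (ne_of_gt hD)
    have hlim := (tendsto_primitive_sub_right hφ hstar.1).div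
      ((Complex.continuous_ofReal.tendsto _).comp (g.tendsto_sub_right (g.star t))) hne
    rw [mul_div_cancel_right₀ _ hne] at hlim
    exact hlim.mono_left (g.derivFilter_le_nhdsGT hD)
  rw [HasDerivAt, Metric.tendsto_nhds]
  intro ε hε
  have hball := Metric.tendsto_nhds.1 (hcont hD) (ε / 2) (half_pos hε)
  obtain ⟨δ, hδ, hball⟩ := Metric.eventually_nhds_iff_ball.1 hball
  filter_upwards [g.derivFilter_le_nhds T t (Metric.ball_mem_nhds _ hδ), g.Icc_mem_derivFilter T t,
    h.eventually_apply_ne ht.2] with s hs hsT hne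
  have hsub : ((g s - g (g.star t) : ℝ) : ℂ) ≠ 0 := Complex.ofReal_ne_zero.2 (sub_ne_zero.2 hne)
  have huIcc := (convex_ball (g.star t) δ).ordConnected.uIcc_subset hs (Metric.mem_ball_self hδ)
  have hle := norm_primitive_sub_sub_le hφ (c := φ (g.star t)) hsT.1 hstar.1 fun r hr =>
    (dist_eq_norm (φ r) _ ▸ hball r (huIcc hr)).le
  rw [dist_eq_norm, quotient, div_sub' hsub, norm_div, Complex.norm_real, Real.norm_eq_abs,
    div_lt_iff₀ (abs_pos.2 (sub_ne_zero.2 hne)), mul_comm _ (φ _)]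
  exact hle.trans_lt (mul_lt_mul_of_pos_right (half_lt_self hε) (abs_pos.2 (sub_ne_zero.2 hne)))

end Primitive

section Exponential

variable {g : Derivator} {T t : ℝ} {l : ℂ}

theorem expIntegrand_eq_mul_dslope (g : Derivator) (l : ℂ) (s : ℝ) :
    g.expIntegrand (fun _ => l) s = l * dslope Complex.log 1 (1 + l * g.jump s) := by
  have hlog := sub_smul_dslope Complex.log 1 (1 + l * g.jump s)
  rw [add_sub_cancel_left, Complex.log_one, sub_zero, smul_eq_mul] at hlog
  unfold expIntegrand
  split_ifs with hD
  · have hjump : (g.jump s : ℂ) ≠ 0 := Complex.ofReal_ne_zero.2 (ne_of_gt hD)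
    rw [← hlog, mul_right_comm, mul_div_cancel_right₀ _ hjump]
  · rw [g.jump_eq_zero hD, Complex.ofReal_zero, mul_zero, add_zero, dslope_same,
      (Complex.hasDerivAt_log Complex.one_mem_slitPlane).deriv, inv_one, mul_one]

theorem tendsto_expIntegrand (g : Derivator) (l : ℂ) (t : ℝ) :
    Tendsto (g.expIntegrand fun _ => l) (𝓝[≠] t) (𝓝 l) := by
  have hlog := Complex.hasDerivAt_log Complex.one_mem_slitPlane
  have hslope : Tendsto (dslope Complex.log 1) (𝓝 1) (𝓝 1) := by
    have hcont := continuousAt_dslope_same.2 hlog.differentiableAt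
    rwa [ContinuousAt, dslope_same, hlog.deriv, inv_one] at hcont
  have hjump : Tendsto (fun s => 1 + l * (g.jump s : ℂ)) (𝓝[≠] t) (𝓝 1) := by
    have hlim := ((Complex.continuous_ofReal.tendsto 0).comp (g.tendsto_jump t)).const_mul l
    simpa using hlim.const_add 1
  have hlim := (hslope.comp hjump).const_mul l
  rw [mul_one] at hlim
  exact hlim.congr fun s => (g.expIntegrand_eq_mul_dslope l s).symm

theorem continuousAt_expIntegrand (l : ℂ) (ht : t ∉ g.D) :
    ContinuousAt (g.expIntegrand fun _ => l) t := by
  rw [continuousAt_iff_punctured_nhds, expIntegrand, if_neg ht]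
  exact g.tendsto_expIntegrand l t

theorem measurable_expIntegrand (g : Derivator) (l : ℂ) :
    Measurable (g.expIntegrand fun _ => l) := by
  refine Measurable.measurable_of_countable_ne (measurable_const (a := l))
    (g.countable_D.mono fun s hs => ?_)
  by_contra hD
  exact hs (if_neg hD).symm

theorem locallyIntegrable_expIntegrand (g : Derivator) (l : ℂ) :
    LocallyIntegrable (g.expIntegrand fun _ => l) g.measure := by
  intro t
  have hbdd : (𝓝 t).IsBoundedUnder (· ≤ ·) (norm ∘ g.expIntegrand fun _ => l) := by
    rw [← nhdsNE_sup_pure, IsBoundedUnder, map_sup]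
    exact isBounded_sup (g.tendsto_expIntegrand l t).norm.isBoundedUnder_le
      (tendsto_pure_nhds _ t).norm.isBoundedUnder_le
  exact (g.measure.finiteAt_nhds t).integrableAtFilter
    (g.measurable_expIntegrand l).stronglyMeasurable.stronglyMeasurableAtFilter hbdd

theorem gexp_eq_exp_comp_primitive (g : Derivator) (p : ℝ → ℂ) :
    g.gexp p = Complex.exp ∘ g.primitive (g.expIntegrand p) := rfl

theorem gexp_zero (g : Derivator) (p : ℝ → ℂ) : g.gexp p 0 = 1 := by
  rw [gexp, Ico_self, setIntegral_empty, Complex.exp_zero]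

theorem gexp_ne_zero (g : Derivator) (p : ℝ → ℂ) (t : ℝ) : g.gexp p t ≠ 0 := Complex.exp_ne_zero _

theorem gexp_mem_BC (g : Derivator) (T : ℝ) (l : ℂ) : g.gexp (fun _ => l) ∈ g.BC T :=
  BC.comp Complex.continuous_exp (primitive_mem_BC (g.locallyIntegrable_expIntegrand l) T)

theorem dslope_exp_mul_expIntegrand (hl : 1 + l * g.jump t ≠ 0) (z : ℂ) :
    dslope Complex.exp z (z + g.expIntegrand (fun _ => l) t * g.jump t) *
      g.expIntegrand (fun _ => l) t = l * Complex.exp z := by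
  by_cases hD : t ∈ g.D
  · have hjump : (g.jump t : ℂ) ≠ 0 := Complex.ofReal_ne_zero.2 (ne_of_gt hD)
    have hlog : g.expIntegrand (fun _ => l) t * g.jump t = Complex.log (1 + l * g.jump t) := by
      rw [expIntegrand, if_pos hD, div_mul_cancel₀ _ hjump]
    have hexp := sub_smul_dslope Complex.exp z (z + g.expIntegrand (fun _ => l) t * g.jump t)
    rw [add_sub_cancel_left, smul_eq_mul, hlog, Complex.exp_add, Complex.exp_log hl] at hexp
    refine mul_right_cancel₀ hjump ?_
    rw [mul_assoc, hlog]
    linear_combination hexp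
  · rw [g.jump_eq_zero hD, Complex.ofReal_zero, mul_zero, add_zero, dslope_same, Complex.deriv_exp,
      expIntegrand, if_neg hD, mul_comm]

theorem hasDerivAt_gexp (h : g.IsAdmissible T) (ht : t ∈ Icc 0 T)
    (hl : 1 + l * g.jump (g.star t) ≠ 0) :
    g.HasDerivAt T (g.gexp fun _ => l) (l * g.gexp (fun _ => l) t) t := by
  have hstar : g.gexp (fun _ => l) (g.star t) = g.gexp (fun _ => l) t :=
    (g.gexp_mem_BC T l).1.apply_eq (h.star_mem ht) ht (apply_star ht.2 h.notMem_C)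
  have hprim := hasDerivAt_primitive (g.locallyIntegrable_expIntegrand l) h ht
    (continuousAt_expIntegrand l)
  rw [← hstar, gexp_eq_exp_comp_primitive, Function.comp_apply, ← dslope_exp_mul_expIntegrand hl]
  exact hprim.comp h ht.2 Complex.differentiableAt_exp Complex.continuous_exp.continuousAt

theorem isSolutionPair_gexp (h : g.IsAdmissible T) (hl : ∀ t ∈ Icc 0 T, 1 + l * g.jump t ≠ 0) :
    g.IsSolutionPair T (fun _ => l ^ 2) (g.gexp fun _ => l) (l • g.gexp fun _ => l) where
  mem_BC := g.gexp_mem_BC T l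
  mem_BC' := Submodule.smul_mem _ l (g.gexp_mem_BC T l)
  hasDerivAt t ht := hasDerivAt_gexp h ht (hl _ (h.star_mem ht))
  hasDerivAt' t ht := by
    rw [sq, mul_assoc]
    exact (hasDerivAt_gexp h ht (hl _ (h.star_mem ht))).const_smul l

end Exponential

section SecondDerivative

variable {g : Derivator} {T : ℝ} {a f f' : ℝ → ℂ}

theorem IsSolutionPair.iterDeriv_one_eqOn (h : g.IsAdmissible T) (hf : g.IsSolutionPair T a f f') :
    EqOn f' (g.iterDeriv T 1 f) (Icc 0 T) :=
  fun t ht => ((hf.hasDerivAt t ht).deriv h ht).symm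

theorem IsSolutionPair.iterDeriv_two_eqOn (h : g.IsAdmissible T) (hf : g.IsSolutionPair T a f f') :
    EqOn (a * f) (g.iterDeriv T 2 f) (Icc 0 T) := fun t ht =>
  (((hf.hasDerivAt' t ht).congr h ht (hf.iterDeriv_one_eqOn h)).deriv h ht).symm

theorem IsSolutionPair.memBC_two (h : g.IsAdmissible T) (hf : g.IsSolutionPair T a f f')
    (haf : a * f ∈ g.BC T) : g.MemBC T 2 f := by
  have hf' : g.iterDeriv T 1 f ∈ g.BC T := BC.congr hf.mem_BC' (hf.iterDeriv_one_eqOn h)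
  have hf'' : g.iterDeriv T 2 f ∈ g.BC T := BC.congr haf (hf.iterDeriv_two_eqOn h)
  refine ⟨⟨⟨hf.mem_BC.1, fun t ht => ⟨f' t, hf.hasDerivAt t ht⟩, hf'.1⟩,
    fun t ht => ?_, hf''.1⟩, fun n hn => ?_⟩
  · exact ⟨_, (hf.hasDerivAt' t ht).congr h ht (hf.iterDeriv_one_eqOn h)⟩
  · interval_cases n
    exacts [hf.mem_BC.2, hf'.2, hf''.2]

theorem MemBC.isSolutionPair (hf : g.MemBC T 2 f)
    (haf : EqOn (g.iterDeriv T 2 f) (a * f) (Icc 0 T)) : g.IsSolutionPair T a f (g.deriv T f) where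
  mem_BC := ⟨hf.1.1.1, hf.2 0 zero_le_two⟩
  mem_BC' := ⟨hf.1.1.2.2, hf.2 1 one_le_two⟩
  hasDerivAt t ht := (hf.1.1.2.1 t ht).hasDerivAt
  hasDerivAt' t ht := by
    rw [← Pi.mul_apply a, ← haf ht]
    exact (hf.1.2.1 t ht).hasDerivAt

end SecondDerivative

end Derivator

section Helmholtz

open Derivator

variable {g : Derivator} {T t₁ w w₁ w₂ : ℝ} {x₀ v₀ : ℂ} {v v' : ℝ → ℂ}

theorem neg_helmholtzCoeff_sq (t₁ w₁ w₂ : ℝ) :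
    (fun t => -(helmholtzCoeff t₁ w₁ w₂ t : ℂ) ^ 2) =
      (Iic t₁).piecewise (fun _ => -(w₁ : ℂ) ^ 2) (fun _ => -(w₂ : ℂ) ^ 2) := by
  ext t
  by_cases ht : t ≤ t₁
  · rw [helmholtzCoeff, if_pos ht, piecewise_eq_of_mem _ _ _ (mem_Iic.2 ht)]
  · rw [helmholtzCoeff, if_neg ht, piecewise_eq_of_notMem _ _ _ (notMem_Iic.2 (not_le.1 ht))]

theorem norm_neg_helmholtzCoeff_sq_le (t₁ w₁ w₂ t : ℝ) :
    ‖-(helmholtzCoeff t₁ w₁ w₂ t : ℂ) ^ 2‖ ≤ max (w₁ ^ 2) (w₂ ^ 2) := by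
  rw [norm_neg, norm_pow, Complex.norm_real, Real.norm_eq_abs, sq_abs, helmholtzCoeff]
  split_ifs
  exacts [le_max_left _ _, le_max_right _ _]

theorem Derivator.IsSolutionPair.isHelmholtzSolution (h : g.IsAdmissible T) (ht₁ : t₁ ∈ g.D)
    (hv : g.IsSolutionPair T (fun t => -(helmholtzCoeff t₁ w₁ w₂ t : ℂ) ^ 2) v v') :
    IsHelmholtzSolution g T t₁ w₁ w₂ v := by
  refine ⟨hv.memBC_two h ?_, fun t ht => ?_⟩
  · rw [neg_helmholtzCoeff_sq, ← piecewise_same (Iic t₁) v, ← piecewise_mul]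
    exact BC.piecewise ht₁ (Submodule.smul_mem _ _ hv.mem_BC) (Submodule.smul_mem _ _ hv.mem_BC)
  · rw [← hv.iterDeriv_two_eqOn h ht, Pi.mul_apply, neg_mul, neg_add_cancel]

theorem IsHelmholtzSolution.isSolutionPair (hv : IsHelmholtzSolution g T t₁ w₁ w₂ v) :
    g.IsSolutionPair T (fun t => -(helmholtzCoeff t₁ w₁ w₂ t : ℂ) ^ 2) v (g.deriv T v) :=
  hv.1.isSolutionPair fun t ht => by
    rw [Pi.mul_apply, neg_mul, eq_neg_iff_add_eq_zero, hv.2 t ht]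

theorem IsHelmholtzIVPSolution.eqOn {u : ℝ → ℂ}
    (hu : IsHelmholtzIVPSolution g T t₁ w₁ w₂ x₀ v₀ u)
    (hv : IsHelmholtzIVPSolution g T t₁ w₁ w₂ x₀ v₀ v) : EqOn u v (Icc 0 T) :=
  hu.1.isSolutionPair.eqOn (fun t _ => norm_neg_helmholtzCoeff_sq_le t₁ w₁ w₂ t)
    hv.1.isSolutionPair (hu.2.1.trans hv.2.1.symm) (hu.2.2.trans hv.2.2.symm)

theorem helmholtzExponent_sq (w : ℝ) (k : Fin 2) : helmholtzExponent w k ^ 2 = -(w : ℂ) ^ 2 := by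
  fin_cases k <;> simp [helmholtzExponent, mul_pow]

theorem helmholtzExponent_sub_ne_zero (hw : w ≠ 0) :
    helmholtzExponent w 1 - helmholtzExponent w 0 ≠ 0 := by
  have hsub : helmholtzExponent w 1 - helmholtzExponent w 0 = -(2 * Complex.I * w) := by
    simp only [helmholtzExponent, Matrix.cons_val_zero, Matrix.cons_val_one]
    ring
  simp [hsub, hw]

theorem one_add_helmholtzExponent_mul_ne_zero (w : ℝ) (k : Fin 2) (x : ℝ) :
    1 + helmholtzExponent w k * x ≠ 0 := by
  intro h
  have hre := congr_arg Complex.re h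
  fin_cases k <;> simp [helmholtzExponent] at hre

theorem isSolutionPair_gexp_helmholtzExponent (h : g.IsAdmissible T) (w : ℝ) (k : Fin 2) :
    g.IsSolutionPair T (fun _ => -(w : ℂ) ^ 2) (g.gexp fun _ => helmholtzExponent w k)
      (helmholtzExponent w k • g.gexp fun _ => helmholtzExponent w k) := by
  rw [← helmholtzExponent_sq w k]
  exact isSolutionPair_gexp h fun t _ => one_add_helmholtzExponent_mul_ne_zero w k (g.jump t)

theorem helmholtzAlpha₁_mul (hw₂ : w₂ ≠ 0) (k : Fin 2) :
    helmholtzAlpha₁ g t₁ w₁ w₂ k * (g.gexp (fun _ => helmholtzExponent w₂ 0) t₁ *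
        (1 + helmholtzExponent w₂ 0 * g.jump t₁) *
        (helmholtzExponent w₂ 1 - helmholtzExponent w₂ 0)) =
      g.gexp (fun _ => helmholtzExponent w₁ k) t₁ * (1 + helmholtzExponent w₁ k * g.jump t₁) *
        (helmholtzExponent w₂ 1 - helmholtzExponent w₁ k) :=
  div_mul_cancel₀ _ (mul_ne_zero (mul_ne_zero (g.gexp_ne_zero _ t₁)
    (one_add_helmholtzExponent_mul_ne_zero w₂ 0 _)) (helmholtzExponent_sub_ne_zero hw₂))

theorem helmholtzAlpha₂_mul (hw₂ : w₂ ≠ 0) (k : Fin 2) :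
    helmholtzAlpha₂ g t₁ w₁ w₂ k * (g.gexp (fun _ => helmholtzExponent w₂ 1) t₁ *
        (1 + helmholtzExponent w₂ 1 * g.jump t₁) *
        (helmholtzExponent w₂ 1 - helmholtzExponent w₂ 0)) =
      g.gexp (fun _ => helmholtzExponent w₁ k) t₁ * (1 + helmholtzExponent w₁ k * g.jump t₁) *
        (helmholtzExponent w₁ k - helmholtzExponent w₂ 0) :=
  div_mul_cancel₀ _ (mul_ne_zero (mul_ne_zero (g.gexp_ne_zero _ t₁)
    (one_add_helmholtzExponent_mul_ne_zero w₂ 1 _)) (helmholtzExponent_sub_ne_zero hw₂))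

theorem helmholtzY_eqOn_piecewise (g : Derivator) (T t₁ w₁ w₂ : ℝ) (k : Fin 2) :
    EqOn ((Iic t₁).piecewise (g.gexp fun _ => helmholtzExponent w₁ k)
      (helmholtzAlpha₁ g t₁ w₁ w₂ k • (g.gexp fun _ => helmholtzExponent w₂ 0) +
        helmholtzAlpha₂ g t₁ w₁ w₂ k • (g.gexp fun _ => helmholtzExponent w₂ 1)))
      (helmholtzY g T t₁ w₁ w₂ k) (Icc 0 T) := by
  intro t ht
  rw [helmholtzY]
  rcases le_or_gt t t₁ with htt₁ | htt₁
  · rw [piecewise_eq_of_mem _ _ _ (mem_Iic.2 htt₁), indicator_of_mem (mem_Icc.2 ⟨ht.1, htt₁⟩),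
      indicator_of_notMem fun hm => hm.1.not_ge htt₁, add_zero]
  · rw [piecewise_eq_of_notMem _ _ _ (notMem_Iic.2 htt₁), indicator_of_mem (mem_Ioc.2 ⟨htt₁, ht.2⟩),
      indicator_of_notMem fun hm => hm.2.not_gt htt₁, zero_add]
    rfl

/-- The `g`-derivative of `helmholtzY` on `[0, T]`. -/
noncomputable def helmholtzYDeriv (g : Derivator) (t₁ w₁ w₂ : ℝ) (k : Fin 2) : ℝ → ℂ :=
  (Iic t₁).piecewise (helmholtzExponent w₁ k • g.gexp fun _ => helmholtzExponent w₁ k)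
    (helmholtzAlpha₁ g t₁ w₁ w₂ k •
        (helmholtzExponent w₂ 0 • g.gexp fun _ => helmholtzExponent w₂ 0) +
      helmholtzAlpha₂ g t₁ w₁ w₂ k •
        (helmholtzExponent w₂ 1 • g.gexp fun _ => helmholtzExponent w₂ 1))

theorem helmholtzY_zero (ht₁ : 0 ≤ t₁) (k : Fin 2) : helmholtzY g T t₁ w₁ w₂ k 0 = 1 := by
  rw [helmholtzY, indicator_of_mem (left_mem_Icc.2 ht₁),
    indicator_of_notMem fun hm => hm.1.not_ge ht₁, add_zero, g.gexp_zero]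

theorem helmholtzYDeriv_zero (ht₁ : 0 ≤ t₁) (k : Fin 2) :
    helmholtzYDeriv g t₁ w₁ w₂ k 0 = helmholtzExponent w₁ k := by
  rw [helmholtzYDeriv, piecewise_eq_of_mem _ _ _ (mem_Iic.2 ht₁), Pi.smul_apply, g.gexp_zero,
    smul_eq_mul, mul_one]

theorem isSolutionPair_helmholtzY (h : g.IsAdmissible T) (ht₁ : t₁ ∈ Icc 0 T ∩ g.D) (hw₂ : w₂ ≠ 0)
    (k : Fin 2) : g.IsSolutionPair T (fun t => -(helmholtzCoeff t₁ w₁ w₂ t : ℂ) ^ 2)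
      (helmholtzY g T t₁ w₁ w₂ k) (helmholtzYDeriv g t₁ w₁ w₂ k) := by
  have hα₁ := helmholtzAlpha₁_mul (g := g) (t₁ := t₁) (w₁ := w₁) hw₂ k
  have hα₂ := helmholtzAlpha₂_mul (g := g) (t₁ := t₁) (w₁ := w₁) hw₂ k
  have hne := helmholtzExponent_sub_ne_zero hw₂
  have hpair := isSolutionPair_gexp_helmholtzExponent h
  rw [neg_helmholtzCoeff_sq]
  refine IsSolutionPair.congr h (.piecewise h ht₁ (hpair w₁ k)
    (((hpair w₂ 0).const_smul _).add ((hpair w₂ 1).const_smul _)) ?_ ?_)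
    (helmholtzY_eqOn_piecewise g T t₁ w₁ w₂ k) (eqOn_refl _ _)
  · refine mul_right_cancel₀ hne ?_
    simp only [Pi.add_apply, Pi.smul_apply, smul_eq_mul]
    linear_combination -hα₁ - hα₂
  · refine mul_right_cancel₀ hne ?_
    simp only [Pi.add_apply, Pi.smul_apply, smul_eq_mul, ← helmholtzExponent_sq w₁ k]
    linear_combination -helmholtzExponent w₂ 0 * hα₁ - helmholtzExponent w₂ 1 * hα₂ +
      (helmholtzExponent w₂ 1 - helmholtzExponent w₂ 0) * g.jump t₁ *
        (helmholtzAlpha₁ g t₁ w₁ w₂ k * g.gexp (fun _ => helmholtzExponent w₂ 0) t₁ *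
            helmholtzExponent_sq w₂ 0 +
          helmholtzAlpha₂ g t₁ w₁ w₂ k * g.gexp (fun _ => helmholtzExponent w₂ 1) t₁ *
            helmholtzExponent_sq w₂ 1)

theorem linearIndependent_helmholtzY (h : g.IsAdmissible T) (ht₁ : t₁ ∈ Icc 0 T ∩ g.D)
    (hw₁ : w₁ ≠ 0) (hw₂ : w₂ ≠ 0) :
    LinearIndependent ℂ fun k : Fin 2 => (Icc 0 T).domRestrict (helmholtzY g T t₁ w₁ w₂ k) := by
  have h0 : (0 : ℝ) ∈ Icc 0 T := left_mem_Icc.2 h.pos.le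
  refine linearIndependent_of_wronskian_ne_zero h h0
    (fun k => (isSolutionPair_helmholtzY h ht₁ hw₂ k).hasDerivAt 0 h0) ?_
  simpa only [helmholtzY_zero ht₁.1.1, helmholtzYDeriv_zero ht₁.1.1, one_mul] using
    helmholtzExponent_sub_ne_zero hw₁

theorem isHelmholtzIVPSolution_helmholtzVh (h : g.IsAdmissible T) (ht₁ : t₁ ∈ Icc 0 T ∩ g.D)
    (hw₁ : w₁ ≠ 0) (hw₂ : w₂ ≠ 0) (x₀ v₀ : ℂ) :
    IsHelmholtzIVPSolution g T t₁ w₁ w₂ x₀ v₀ (helmholtzVh g T t₁ w₁ w₂ x₀ v₀) := by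
  have h0 : (0 : ℝ) ∈ Icc 0 T := left_mem_Icc.2 h.pos.le
  have hne := helmholtzExponent_sub_ne_zero hw₁
  have hpair := ((isSolutionPair_helmholtzY (w₁ := w₁) h ht₁ hw₂ 0).const_smul
    ((helmholtzExponent w₁ 1 * x₀ - v₀) / (helmholtzExponent w₁ 1 - helmholtzExponent w₁ 0))).add
    ((isSolutionPair_helmholtzY h ht₁ hw₂ 1).const_smul
    ((v₀ - helmholtzExponent w₁ 0 * x₀) / (helmholtzExponent w₁ 1 - helmholtzExponent w₁ 0)))
  refine ⟨hpair.isHelmholtzSolution h ht₁.2, ?_, ((hpair.hasDerivAt 0 h0).deriv h h0).trans ?_⟩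
  · simp only [helmholtzVh, helmholtzY_zero ht₁.1.1]
    field_simp
    ring
  · simp only [Pi.add_apply, Pi.smul_apply, smul_eq_mul, helmholtzYDeriv_zero ht₁.1.1]
    field_simp
    ring

end Helmholtz

theorem mainTheorem8_general (g : Derivator) (T : ℝ) (h0 : (0 : ℝ) ∉ g.Nminus)
    (hT' : T ∉ g.Nplus ∪ g.D ∪ g.C) (t₁ : ℝ) (ht₁ : t₁ ∈ Set.Icc 0 T ∩ g.D)
    (w₁ w₂ : ℝ) (hw₁ : w₁ ≠ 0) (hw₂ : w₂ ≠ 0) :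
    (∀ k : Fin 2, IsHelmholtzSolution g T t₁ w₁ w₂ (helmholtzY g T t₁ w₁ w₂ k)) ∧
    LinearIndependent ℂ (fun k : Fin 2 => (Set.Icc 0 T).domRestrict (helmholtzY g T t₁ w₁ w₂ k)) ∧
    ∀ x₀ v₀ : ℂ,
      IsHelmholtzIVPSolution g T t₁ w₁ w₂ x₀ v₀ (helmholtzVh g T t₁ w₁ w₂ x₀ v₀) ∧
      ∀ v : ℝ → ℂ, IsHelmholtzIVPSolution g T t₁ w₁ w₂ x₀ v₀ v →
        Set.EqOn v (helmholtzVh g T t₁ w₁ w₂ x₀ v₀) (Set.Icc 0 T) := by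
  simp only [mem_union, not_or] at hT'
  have hT : 0 < T := ht₁.1.1.trans_lt (ht₁.1.2.lt_of_ne fun heq => hT'.1.2 (heq ▸ ht₁.2))
  have h : g.IsAdmissible T := ⟨hT, h0, hT'.1.1, hT'.1.2, hT'.2⟩
  have hVh := isHelmholtzIVPSolution_helmholtzVh h ht₁ hw₁ hw₂
  exact ⟨fun k => (isSolutionPair_helmholtzY h ht₁ hw₂ k).isHelmholtzSolution h ht₁.2,
    linearIndependent_helmholtzY h ht₁ hw₁ hw₂,
    fun x₀ v₀ => ⟨hVh x₀ v₀, fun v hv => hv.eqOn (hVh x₀ v₀)⟩⟩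

theorem mainTheorem8 (g : Derivator) (T : ℝ) (hT : 0 < T)
    (h0 : (0 : ℝ) ∉ g.D ∪ g.Nminus) (hT' : T ∉ g.Nplus ∪ g.D ∪ g.C)
    (t₁ : ℝ) (ht₁ : t₁ ∈ Set.Icc 0 T ∩ g.D)
    (w₁ w₂ : ℝ) (hw₁ : w₁ ≠ 0) (hw₂ : w₂ ≠ 0) :
    (∀ k : Fin 2, IsHelmholtzSolution g T t₁ w₁ w₂ (helmholtzY g T t₁ w₁ w₂ k)) ∧
    LinearIndependent ℂ (fun k : Fin 2 => (Set.Icc 0 T).domRestrict (helmholtzY g T t₁ w₁ w₂ k)) ∧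
    ∀ x₀ v₀ : ℂ,
      IsHelmholtzIVPSolution g T t₁ w₁ w₂ x₀ v₀ (helmholtzVh g T t₁ w₁ w₂ x₀ v₀) ∧
      ∀ v : ℝ → ℂ, IsHelmholtzIVPSolution g T t₁ w₁ w₂ x₀ v₀ v →
        Set.EqOn v (helmholtzVh g T t₁ w₁ w₂ x₀ v₀) (Set.Icc 0 T) :=
  mainTheorem8_general g T (fun h => h0 (Or.inr h)) hT' t₁ ht₁ w₁ w₂ hw₁ hw₂
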